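/- **Theorem (Optimality of bit allocation).** Let $M\ge 2$ be fixed, let $L\ge 2$, and let $g\in\mathbb R^{ML}$ have i.i.d. standard Gaussian entries. Write $\rho=\|g\|$, $f=g/\|g\|$, split $f$ into $M$ consecutive blocks $v_1,\dots,v_M$ of length $L$, and put $s_i=v_i/\|v_i\|$ and $h=(\|v_1\|,\dots,\|v_M\|)$. For unit vectors let $d_c(x,y)=\sqrt{1-|x^Ty|^2}$. *Hierarchical quantizer with $(B_\rho,B_s,B_h)$ bits.* $\mathcal C_\rho$ is the uniform scalar codebook consisting of the midpoints of the $2^{B_\rho}$ equal subintervals of $[0,\rho_{\max}]$, where $\rho_{\max}=ML+\sqrt{2ML}$. $\mathcal C_s\subset\mathbb R^L$ is a set of $2^{B_s}$ unit vectors that is even (a disjoint union $\mathcal C^+\cup(-\mathcal C^+)$) and minimizes $\mathbb E[\min_{c\in\mathcal C}d_c(s_i,c)^2]$ among all such sets $\mathcal C$. $\mathcal C_h\subset\mathbb R^M$ is a set of $2^{B_h}$ unit vectors with positive entries that minimizes $\mathbb E[\min_{c\in\mathcal C}d_c(h,c)^2]$ among all such sets $\mathcal C$. With $\hat\rho,\hat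 s_i,\hat h$ the Euclidean-nearest codewords to $\rho,s_i,h$ (chosen measurably), the quantized gradient is $\hat g=\hat\rho\,(\hat h_1\hat s_1^T,\dots,\hat h_M\hat s_M^T)^T$. *Bit allocation.* For a total of $B\in\mathbb N$ bits let $$B^*_\rho=\Big\lfloor\log_2\tfrac{ML+\sqrt{2ML}}2+\tfrac12\log_2\ln2+\tfrac12-\tfrac12\log_2\lambda^*\Big\rfloor,$$ $$B^*_s=\Big\lfloor\tfrac{L-1}2\log_2\tfrac{2L}{L-1}+1+\tfrac{L-1}2\log_2\ln 2-\tfrac{L-1}2\log_2\lambda^*\Big\rfloor,$$ $$B^*_h=\Big\lfloor\tfrac{M-1}2\log_2\tfrac2{M-1}+\tfrac{M-1}2\log_2(\beta_LM\sqrt L)+\tfrac{M-1}2\log_2\ln2-\tfrac{M-1}2\log_2\lambda^*\Big\rfloor,$$ where $\beta_L=\frac{1+L^{-1/16}}{1-L^{-1/16}}$ and $\lambda^*$ is the value for which the three expressions before rounding satisfy $B_\rho+MB_s+B_h=B$, that is, $$\log_2\lambda^*=\tfrac2{ML}\log_2\tfrac{ML+\sqrt{2ML}}2+\tfrac{L-1}L\log_2\tfrac{2L}{L-1}+\tfrac2L+\tfrac1{ML}+\tfrac{M-1}{ML}\log_2\tfrac2{M-1}+\tfrac{M-1}{ML}\log_2(\beta_LM\sqrt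 L)+\log_2\ln2-\tfrac{2B}{ML}.$$ *Claim.* There are $L_0$ and a function $\varepsilon(L)=O(L^{-3/2})$ as $L\to\infty$, both depending only on $M$, such that for all $L\ge L_0$, all $B\le ML$ for which the allocation is realizable ($B^*_\rho\ge0$, $B^*_s\ge1$, $B^*_h\ge0$), and every hierarchical quantizer as above with $(B^*_\rho,B^*_s,B^*_h)$ bits, $\mathbb E\|g-\hat g\|^2$ is finite and positive and $$-\frac{2\ln2}{ML}B\;\le\;\ln\frac{\mathbb E\|g-\hat g\|^2}{ML}\;\le\;c_{\rm gap}-\frac{2\ln2}{ML}B+\varepsilon(L),$$ where $$c_{\rm gap}=\ln2-\ln\tfrac{2L}{L-1}+\tfrac2{ML}\ln\tfrac{ML+\sqrt{ML}}2+\tfrac{L-1}L\ln\tfrac{2L}{L-1}+\tfrac2L\ln2+\tfrac{2(M-1)}{ML}\ln\tfrac2{M-1}+\tfrac{\ln2}{ML}+\tfrac{M-1}{ML}\ln(\beta_LM\sqrt L)+2(\beta_L+1)L^{-1/2}-2(\beta_L+1)^2L^{-1}.$$ -/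

import Mathlib

open MeasureTheory ProbabilityTheory Filter Asymptotics

namespace HierQuant

noncomputable section

/-- Gradients with `M` blocks of length `L`, as vectors of the Euclidean space `ℝ^(M L)`;
the entry `(i, j)` is the `j`-th coordinate of the `i`-th block. -/
abbrev Grad (M L : ℕ) : Type := EuclideanSpace ℝ (Fin M × Fin L)

/-! ### Decomposition of a gradient -/

/-- The vector `v / ‖v‖`. -/
def normalized {E : Type*} [NormedAddCommGroup E] [NormedSpace ℝ E] (v : E) : E := ‖v‖⁻¹ • v

/-- The `i`-th block of a vector. -/
def block {M L : ℕ} (f : Grad M L) (i : Fin M) : EuclideanSpace ℝ (Fin L) :=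
  WithLp.toLp 2 fun j => f (i, j)

/-- The hinge vector `h` of `g`: `h i` is the norm of the `i`-th block of `g / ‖g‖`. -/
def hinge {M L : ℕ} (g : Grad M L) : EuclideanSpace ℝ (Fin M) :=
  WithLp.toLp 2 fun i => ‖block (normalized g) i‖

/-- The `i`-th normalized block gradient `s i` of `g`. -/
def normBlock {M L : ℕ} (g : Grad M L) (i : Fin M) : EuclideanSpace ℝ (Fin L) :=
  normalized (block (normalized g) i)

/-! ### Codebooks and quantizers -/

/-- The chordal distance `√(1 - |xᵀ y|²)` of two unit vectors. -/
def chordalDist {n : ℕ} (x y : EuclideanSpace ℝ (Fin n)) : ℝ :=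
  Real.sqrt (1 - |inner ℝ x y| ^ 2)

/-- A Grassmannian codebook of `b` bits: a set of `2 ^ b` unit vectors. -/
def IsGrassmannian {n : ℕ} (b : ℕ) (C : Finset (EuclideanSpace ℝ (Fin n))) : Prop :=
  C.card = 2 ^ b ∧ ∀ c ∈ C, ‖c‖ = 1

open Classical in
/-- An even codebook: the disjoint union of some `C⁺` and `C⁻ = {-c | c ∈ C⁺}`. -/
def IsEven {n : ℕ} (C : Finset (EuclideanSpace ℝ (Fin n))) : Prop :=
  ∃ P : Finset (EuclideanSpace ℝ (Fin n)),
    Disjoint P (P.image fun c => -c) ∧ C = P ∪ P.image fun c => -c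

/-- A positive codebook: all codewords have only positive entries. -/
def IsPositive {n : ℕ} (C : Finset (EuclideanSpace ℝ (Fin n))) : Prop :=
  ∀ c ∈ C, ∀ i, 0 < c i

/-- The average distortion `E[min_{c ∈ C} d_c(X, c)²]` of the codebook `C` for the source `X`. -/
def chordalDistortion {Ω : Type*} [MeasurableSpace Ω] {n : ℕ} (P : Measure Ω)
    (X : Ω → EuclideanSpace ℝ (Fin n)) (C : Finset (EuclideanSpace ℝ (Fin n))) : ℝ :=
  ∫ ω, ⨅ c : C, chordalDist (X ω) c ^ 2 ∂P

/-- `Q` maps every point to a codeword of `C` at minimal Euclidean distance. -/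
def IsNearest {E : Type*} [NormedAddCommGroup E] [MeasurableSpace E] (C : Finset E)
    (Q : E → E) : Prop :=
  Measurable Q ∧ ∀ x, Q x ∈ C ∧ ∀ c ∈ C, ‖x - Q x‖ ≤ ‖x - c‖

/-- The value `ρ_max = ML + √(2ML)`. -/
def rhoMax (M L : ℕ) : ℝ := (M : ℝ) * L + Real.sqrt (2 * (M * L))

open Classical in
/-- The uniform scalar codebook of `b` bits on `[0, r]`: the midpoints of the `2 ^ b` intervals of
length `r / 2 ^ b` that partition `[0, r]`. -/
def uniformCodebook (r : ℝ) (b : ℕ) : Finset ℝ :=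
  (Finset.range (2 ^ b)).image fun k : ℕ => ((k : ℝ) + 1 / 2) * (r / 2 ^ b)

/-- A hierarchical quantizer for the standard Gaussian gradient with `M` blocks of length `L`, with
`bρ` bits for the norm, `bs` bits for each normalized block and `bh` bits for the hinge vector. -/
structure HierarchicalQuantizer (M L bρ bs bh : ℕ) where
  /-- codebook of the normalized block gradients -/
  Cs : Finset (EuclideanSpace ℝ (Fin L))
  /-- codebook of the hinge vector -/
  Ch : Finset (EuclideanSpace ℝ (Fin M))
  /-- quantization function of the norm -/
  Qρ : ℝ → ℝ
  /-- quantization function of the normalized block gradients -/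
  Qs : EuclideanSpace ℝ (Fin L) → EuclideanSpace ℝ (Fin L)
  /-- quantization function of the hinge vector -/
  Qh : EuclideanSpace ℝ (Fin M) → EuclideanSpace ℝ (Fin M)
  Cs_grassmannian : IsGrassmannian bs Cs
  Cs_even : IsEven Cs
  Cs_optimal : ∀ C, IsGrassmannian bs C → IsEven C → ∀ i : Fin M,
    chordalDistortion (stdGaussian (Grad M L)) (fun g => normBlock g i) Cs ≤
      chordalDistortion (stdGaussian (Grad M L)) (fun g => normBlock g i) C
  Ch_grassmannian : IsGrassmannian bh Ch
  Ch_positive : IsPositive Ch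
  Ch_optimal : ∀ C, IsGrassmannian bh C → IsPositive C →
    chordalDistortion (stdGaussian (Grad M L)) hinge Ch ≤
      chordalDistortion (stdGaussian (Grad M L)) hinge C
  Qρ_nearest : IsNearest (uniformCodebook (rhoMax M L) bρ) Qρ
  Qs_nearest : IsNearest Cs Qs
  Qh_nearest : IsNearest Ch Qh

/-- The quantized gradient `ĝ = ρ̂ [ĥ₁ ŝ₁ᵀ, …, ĥ_M ŝ_Mᵀ]ᵀ`. -/
def HierarchicalQuantizer.quantize {M L bρ bs bh : ℕ} (q : HierarchicalQuantizer M L bρ bs bh)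
    (g : Grad M L) : Grad M L :=
  WithLp.toLp 2 fun p => q.Qρ ‖g‖ * (q.Qh (hinge g) p.1 * q.Qs (normBlock g p.1) p.2)

/-- The mean squared error `E‖g - ĝ‖²` for `g` with i.i.d. `N(0, 1)` entries. -/
def HierarchicalQuantizer.mse {M L bρ bs bh : ℕ} (q : HierarchicalQuantizer M L bρ bs bh) : ℝ :=
  ∫ g, ‖g - q.quantize g‖ ^ 2 ∂(stdGaussian (Grad M L))

/-! ### Bit allocation -/

/-- `β_L = (1 + L^(-1/16)) / (1 - L^(-1/16))`. -/
def beta (L : ℕ) : ℝ := (1 + (L : ℝ) ^ (-(1 / 16) : ℝ)) / (1 - (L : ℝ) ^ (-(1 / 16) : ℝ))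

/-- The binary logarithm of the Lagrange multiplier `λ*`, the value for which the bit constraint
holds (see `bit_constraint`). -/
def logLambda (M L B : ℕ) : ℝ :=
  2 / (M * L) * Real.logb 2 (rhoMax M L / 2)
    + (L - 1) / L * Real.logb 2 (2 * L / (L - 1))
    + 2 / L + 1 / (M * L)
    + (M - 1) / (M * L) * Real.logb 2 (2 / (M - 1))
    + (M - 1) / (M * L) * Real.logb 2 (beta L * M * Real.sqrt L)
    + Real.logb 2 (Real.log 2) - 2 * B / (M * L)

/-- Bits for the norm, before rounding. -/
def realBitsNorm (M L B : ℕ) : ℝ :=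
  Real.logb 2 (rhoMax M L / 2) + 1 / 2 * Real.logb 2 (Real.log 2) + 1 / 2
    - 1 / 2 * logLambda M L B

/-- Bits for each normalized block, before rounding. -/
def realBitsBlock (M L B : ℕ) : ℝ :=
  (L - 1) / 2 * Real.logb 2 (2 * L / (L - 1)) + 1 + (L - 1) / 2 * Real.logb 2 (Real.log 2)
    - (L - 1) / 2 * logLambda M L B

/-- Bits for the hinge vector, before rounding. -/
def realBitsHinge (M L B : ℕ) : ℝ :=
  (M - 1) / 2 * Real.logb 2 (2 / (M - 1)) + (M - 1) / 2 * Real.logb 2 (beta L * M * Real.sqrt L)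
    + (M - 1) / 2 * Real.logb 2 (Real.log 2) - (M - 1) / 2 * logLambda M L B

/-- The numbers before rounding satisfy the bit constraint `B_ρ + M B_s + B_h = B`. -/
theorem bit_constraint (M L B : ℕ) (hM : M ≠ 0) (hL : L ≠ 0) :
    realBitsNorm M L B + M * realBitsBlock M L B + realBitsHinge M L B = B := by
  have hM' : (M : ℝ) ≠ 0 := Nat.cast_ne_zero.mpr hM
  have hL' : (L : ℝ) ≠ 0 := Nat.cast_ne_zero.mpr hL
  unfold realBitsNorm realBitsBlock realBitsHinge logLambda
  generalize Real.logb 2 (rhoMax M L / 2) = a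
  generalize Real.logb 2 (2 * (L : ℝ) / (L - 1)) = b
  generalize Real.logb 2 (2 / ((M : ℝ) - 1)) = c
  generalize Real.logb 2 (beta L * M * Real.sqrt L) = d
  generalize Real.logb 2 (Real.log 2) = e
  field_simp
  ring

/-- `B_ρ*`, the number of bits for the norm. -/
def bitsNorm (M L B : ℕ) : ℤ := ⌊realBitsNorm M L B⌋

/-- `B_s*`, the number of bits for each normalized block. -/
def bitsBlock (M L B : ℕ) : ℤ := ⌊realBitsBlock M L B⌋

/-- `B_h*`, the number of bits for the hinge vector. -/
def bitsHinge (M L B : ℕ) : ℤ := ⌊realBitsHinge M L B⌋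

/-- The bit allocation can be realized: no number of bits is negative, and the even codebook
of the normalized blocks gets at least one bit. -/
def Realizable (M L B : ℕ) : Prop :=
  0 ≤ bitsNorm M L B ∧ 1 ≤ bitsBlock M L B ∧ 0 ≤ bitsHinge M L B

/-- The constant `c_gap`. -/
def cGap (M L : ℕ) : ℝ :=
  Real.log 2 - Real.log (2 * L / (L - 1))
    + 2 / (M * L) * Real.log ((M * L + Real.sqrt (M * L)) / 2)
    + (L - 1) / L * Real.log (2 * L / (L - 1))
    + 2 / L * Real.log 2
    + 2 * (M - 1) / (M * L) * Real.log (2 / (M - 1))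
    + Real.log 2 / (M * L)
    + (M - 1) / (M * L) * Real.log (beta L * M * Real.sqrt L)
    + 2 * (beta L + 1) * (L : ℝ) ^ (-(1 / 2) : ℝ)
    - 2 * (beta L + 1) ^ 2 * (L : ℝ)⁻¹

end

end HierQuant

open HierQuant

/-! The lower bound is rate-distortion theory. The quantizer has at most `2 ^ B` codewords, because
the rounded-down allocation never exceeds `B` (`bits_add_le`). For any finite codebook,
`rate_distortion_aux` compares the Gaussian source with the sum of variance-`D` Gaussian kernels
centred at the codewords.

For the upper bound, `sq_norm_sub_quantize` splits the error into `(ρ - ρ̂)²` plus `2ρρ̂` times an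
error that depends on the direction only. Norm and direction of a Gaussian are independent, so
expectations factor. The norm error is `O(1)` against the total `ML`. The direction error is a hinge
error plus block errors weighted by the hinge; each block is independent of the hinge and the
weights sum to at most one, so a single block distortion suffices.

The hinge error is `O(1/L)` even with one codeword, since all block norms concentrate at `√L`
(`chordalDistortion_hinge_le`). The block distortion is bounded by random coding: ellipsoids inside
double cones give the cap probability, and random codewords leave few directions uncovered. With `R
= B/(ML)` the outcome is `2 ^ (-2R)` up to a relative excess `o(L^(-1/2))` and an additive `1/L`.

Replacing `1 - t` by the squared chordal distance `1 - t²` costs the factor 2 that appears as `ln 2`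
in `cGap`. All other losses stay below `3 L^(-1/2)`, whereas `cGap` offers at least `4 L^(-1/2) -
O(1/L)`. Hence the error term can be taken to be zero for large `L`. -/

namespace HierQuant

/-! ### Density of the standard Gaussian; independence of norm and direction -/

section Gaussian

open Module

variable {E : Type*} [NormedAddCommGroup E] [InnerProductSpace ℝ E] [FiniteDimensional ℝ E]
  [MeasurableSpace E] [BorelSpace E]

/-- The density of the standard Gaussian distribution with respect to the volume. -/
noncomputable def gaussianDensity (E : Type*) [NormedAddCommGroup E] [InnerProductSpace ℝ E]
    (x : E) : ℝ :=
  (2 * Real.pi) ^ (-(finrank ℝ E / 2 : ℝ)) * Real.exp (-(1 / 2) * ‖x‖ ^ 2)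

lemma gaussianDensity_pos (x : E) : 0 < gaussianDensity E x := by
  unfold gaussianDensity; positivity

lemma measurable_gaussianDensity : Measurable (gaussianDensity E) := by
  unfold gaussianDensity; fun_prop

lemma integrable_exp_neg_mul_sq_norm {b : ℝ} (hb : 0 < b) :
    Integrable (fun x : E => Real.exp (-b * ‖x‖ ^ 2)) := by
  have h := (GaussianFourier.integrable_cexp_neg_mul_sq_norm_add (V := E) (b := (b : ℂ))
    (by simpa using hb) 0 0).norm
  refine h.congr (Eventually.of_forall fun x => ?_)
  simp only [Complex.norm_exp]
  congr 1
  simp [← Complex.ofReal_pow]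

lemma integrable_gaussianDensity : Integrable (gaussianDensity E) :=
  (integrable_exp_neg_mul_sq_norm (by norm_num)).const_mul _

lemma charFun_withDensity_gaussianDensity (t : E) :
    charFun (volume.withDensity fun x : E => ENNReal.ofReal (gaussianDensity E x)) t =
      Complex.exp (-‖t‖ ^ 2 / 2) := by
  have hpi : (0 : ℝ) < 2 * Real.pi := by positivity
  rw [charFun_apply, integral_withDensity_eq_integral_toReal_smul
    measurable_gaussianDensity.ennreal_ofReal (by simp)]
  have h := GaussianFourier.integral_cexp_neg_mul_sq_norm_add (V := E) (b := (1 / 2 : ℂ))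
    (by norm_num) Complex.I t
  have key : ∀ x : E, (ENNReal.ofReal (gaussianDensity E x)).toReal •
      Complex.exp (inner ℝ x t * Complex.I) =
      (((2 * Real.pi) ^ (-(finrank ℝ E / 2 : ℝ)) : ℝ) : ℂ) *
        Complex.exp (-(1 / 2) * ‖x‖ ^ 2 + Complex.I * inner ℝ t x) := by
    intro x
    rw [ENNReal.toReal_ofReal (gaussianDensity_pos x).le, gaussianDensity, Complex.exp_add,
      Complex.real_smul, real_inner_comm]
    push_cast
    ring_nf
  simp_rw [key]
  rw [integral_const_mul, h, ← mul_assoc]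
  have h1 : ((Real.pi : ℂ) / (1 / 2)) ^ ((finrank ℝ E : ℂ) / 2) =
      (((2 * Real.pi) ^ (finrank ℝ E / 2 : ℝ) : ℝ) : ℂ) := by
    rw [Complex.ofReal_cpow hpi.le]
    push_cast
    congr 1
    ring
  rw [h1, ← Complex.ofReal_mul, ← Real.rpow_add hpi]
  simp
  ring_nf

/-- The standard Gaussian distribution has a density. -/
lemma stdGaussian_eq_withDensity :
    stdGaussian E = volume.withDensity fun x : E => ENNReal.ofReal (gaussianDensity E x) := by
  have : IsFiniteMeasure (volume.withDensity fun x : E => ENNReal.ofReal (gaussianDensity E x)) :=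
    isFiniteMeasure_withDensity_ofReal integrable_gaussianDensity.2
  apply Measure.ext_of_charFun
  ext t
  rw [charFun_stdGaussian, charFun_withDensity_gaussianDensity]

lemma stdGaussian_absolutelyContinuous : stdGaussian E ≪ volume := by
  rw [stdGaussian_eq_withDensity]
  exact withDensity_absolutelyContinuous _ _

lemma ae_ne_zero_stdGaussian [Nontrivial E] : ∀ᵐ x ∂(stdGaussian E), x ≠ 0 := by
  apply stdGaussian_absolutelyContinuous
  simp

@[fun_prop]
lemma measurable_normalized : Measurable (normalized : E → E) := by
  unfold normalized
  fun_prop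

/-- Under the standard Gaussian distribution, norm and direction are independent. -/
lemma indepFun_normalized_norm [Nontrivial E] :
    IndepFun (normalized : E → E) (fun x => ‖x‖) (stdGaussian E) := by
  classical
  set γ := stdGaussian E with hγ
  set σ := (volume : Measure E).toSphere
  set φ : ℝ → ENNReal := fun r => ENNReal.ofReal
    ((2 * Real.pi) ^ (-(finrank ℝ E / 2 : ℝ)) * Real.exp (-(1 / 2) * r ^ 2)) with hφ
  set ν := Measure.volumeIoiPow (finrank ℝ E - 1)
  have hφm : Measurable φ := by fun_prop
  -- In polar coordinates the volume is surface measure times `r ^ (n - 1) dr`, and the density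
  -- depends on `r` alone, so the joint law is a product.
  have key : ∀ s : Set E, ∀ t : Set ℝ, MeasurableSet s → MeasurableSet t →
      γ (normalized ⁻¹' s ∩ (fun x => ‖x‖) ⁻¹' t) =
        σ ((↑) ⁻¹' s) * ∫⁻ r : Set.Ioi (0 : ℝ), t.indicator φ r ∂ν := by
    intro s t hs ht
    have hmeas : MeasurableSet (normalized ⁻¹' s ∩ (fun x : E => ‖x‖) ⁻¹' t) :=
      (measurable_normalized hs).inter (measurable_norm ht)
    have e1 : γ (normalized ⁻¹' s ∩ (fun x => ‖x‖) ⁻¹' t) =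
        ∫⁻ x : E, (s.indicator 1 (normalized x)) * (t.indicator φ ‖x‖) := by
      rw [hγ, stdGaussian_eq_withDensity, withDensity_apply _ hmeas, ← lintegral_indicator hmeas]
      congr 1 with x
      by_cases h1 : normalized x ∈ s <;> by_cases h2 : ‖x‖ ∈ t <;>
        simp [h1, h2, hφ, gaussianDensity]
    have e2 : (∫⁻ x : E, (s.indicator 1 (normalized x)) * (t.indicator φ ‖x‖)) =
        ∫⁻ x : ({0}ᶜ : Set E), (s.indicator 1 (normalized (x : E))) * (t.indicator φ ‖(x : E)‖)
          ∂(volume.comap Subtype.val) := by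
      rw [lintegral_subtype_comap (measurableSet_singleton _).compl
        (fun x : E => (s.indicator 1 (normalized x)) * (t.indicator φ ‖x‖)),
        Measure.restrict_eq_self_of_ae_mem]
      simp [ae_iff]
    have e3 := (Measure.measurePreserving_homeomorphUnitSphereProd
      (volume : Measure E)).lintegral_comp_emb (Homeomorph.measurableEmbedding _)
      (fun p => (s.indicator (1 : E → ENNReal) (p.1 : E)) * (t.indicator φ (p.2 : ℝ)))
    rw [e1, e2]
    have e4 : (fun x : ↥({0}ᶜ : Set E) =>
        (s.indicator (1 : E → ENNReal) (normalized (x : E))) * (t.indicator φ ‖(x : E)‖)) =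
        fun x => (s.indicator (1 : E → ENNReal) ((homeomorphUnitSphereProd E x).1 : E)) *
          (t.indicator φ ((homeomorphUnitSphereProd E x).2 : ℝ)) := by
      ext x
      simp [normalized]
    rw [e4, e3, lintegral_prod_mul (f := fun p : Metric.sphere (0 : E) 1 => s.indicator 1 (p : E))
      (g := fun r : Set.Ioi (0 : ℝ) => t.indicator φ r)]
    · congr 1
      rw [← lintegral_indicator_one (measurable_subtype_coe hs)]
      rfl
    · exact ((measurable_one.indicator hs).comp measurable_subtype_coe).aemeasurable
    · exact ((hφm.indicator ht).comp measurable_subtype_coe).aemeasurable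
  rw [indepFun_iff_measure_inter_preimage_eq_mul]
  intro s t hs ht
  -- Neither factor is normalized. The two marginals and the total mass 1, all read off from `key`,
  -- turn the product of unnormalized factors into a product of probabilities.
  have h1 := key s Set.univ hs .univ
  have h2 := key Set.univ t .univ ht
  have h3 := key Set.univ Set.univ .univ .univ
  simp only [Set.preimage_univ, Set.inter_univ, Set.univ_inter, measure_univ] at h1 h2 h3
  rw [key s t hs ht, h1, h2, mul_mul_mul_comm, mul_comm (∫⁻ _, _ ∂_) (∫⁻ _, _ ∂_),
    mul_mul_mul_comm, ← h3, mul_one]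

end Gaussian

/-! ### Moments of the norm of a Gaussian vector -/

section Moments

variable {ι : Type*} [Fintype ι]

/-- The variance of the square of a standard Gaussian variable. -/
noncomputable def sqVariance : ℝ := Var[fun z : ℝ => z ^ 2; gaussianReal 0 1]

lemma sqVariance_nonneg : 0 ≤ sqVariance := variance_nonneg _ _

lemma memLp_sq_gaussianReal : MemLp (fun z : ℝ => z ^ 2) 2 (gaussianReal 0 1) := by
  have h := memLp_id_gaussianReal (μ := 0) (v := 1) 4
  refine (memLp_two_iff_integrable_sq (by fun_prop)).2 ?_
  have := h.integrable_norm_pow (by norm_num)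
  refine this.congr (Eventually.of_forall fun x => ?_)
  simp only [id, Real.norm_eq_abs]
  rw [← pow_mul, ← abs_pow, abs_of_nonneg (by positivity)]

lemma integral_sq_gaussianReal : ∫ z, z ^ 2 ∂(gaussianReal 0 1) = 1 := by
  have h := variance_id_gaussianReal (μ := 0) (v := 1)
  rw [variance_eq_integral (by fun_prop)] at h
  simpa using h

lemma map_toLp_measurePreserving : MeasurePreserving (WithLp.toLp 2 : (ι → ℝ) → _)
    (Measure.pi fun _ => gaussianReal 0 1) (stdGaussian (EuclideanSpace ℝ ι)) :=
  ⟨by fun_prop, map_pi_eq_stdGaussian⟩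

lemma sq_norm_toLp : (fun x : ι → ℝ => ‖(WithLp.toLp 2 x : EuclideanSpace ℝ ι)‖ ^ 2) =
    ∑ i, fun x : ι → ℝ => x i ^ 2 := by
  ext x
  simp [EuclideanSpace.norm_sq_eq]

lemma memLp_sq_norm_stdGaussian :
    MemLp (fun x => ‖x‖ ^ 2) 2 (stdGaussian (EuclideanSpace ℝ ι)) := by
  rw [← map_toLp_measurePreserving.map_eq, memLp_map_measure_iff (by fun_prop) (by fun_prop)]
  change MemLp (fun x : ι → ℝ => ‖(WithLp.toLp 2 x : EuclideanSpace ℝ ι)‖ ^ 2) 2 _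
  rw [sq_norm_toLp]
  exact memLp_finsetSum' _ fun i _ =>
    memLp_sq_gaussianReal.comp_measurePreserving (measurePreserving_eval _ i)

lemma integral_sq_norm_stdGaussian :
    ∫ x, ‖x‖ ^ 2 ∂(stdGaussian (EuclideanSpace ℝ ι)) = Fintype.card ι := by
  rw [← map_toLp_measurePreserving.map_eq, integral_map (by fun_prop) (by fun_prop)]
  have h : ∀ i, Integrable (fun x : ι → ℝ => x i ^ 2) (Measure.pi fun _ => gaussianReal 0 1) :=
    fun i => (memLp_sq_gaussianReal.comp_measurePreserving
      (measurePreserving_eval _ i)).integrable (by norm_num)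
  simp_rw [EuclideanSpace.norm_sq_eq, Real.norm_eq_abs, sq_abs]
  rw [integral_finsetSum _ fun i _ => h i]
  have : ∀ i, ∫ x : ι → ℝ, x i ^ 2 ∂(Measure.pi fun _ => gaussianReal 0 1) = 1 := fun i => by
    rw [← integral_sq_gaussianReal]
    exact integral_comp_eval (μ := fun _ : ι => gaussianReal 0 1) (i := i)
      (f := fun z : ℝ => z ^ 2) (by fun_prop)
  simp [this]

lemma variance_sq_norm_stdGaussian :
    Var[fun x => ‖x‖ ^ 2; stdGaussian (EuclideanSpace ℝ ι)] = Fintype.card ι * sqVariance := by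
  rw [← map_toLp_measurePreserving.map_eq, variance_map (by fun_prop) (by fun_prop)]
  change Var[fun x : ι → ℝ => ‖(WithLp.toLp 2 x : EuclideanSpace ℝ ι)‖ ^ 2; _] = _
  rw [sq_norm_toLp]
  have := variance_sum_pi (μ := fun _ : ι => gaussianReal 0 1) (X := fun _ z => z ^ 2)
    fun _ => memLp_sq_gaussianReal
  rw [this]
  simp [sqVariance]

lemma integrable_norm_pow_four_stdGaussian :
    Integrable (fun x => ‖x‖ ^ 4) (stdGaussian (EuclideanSpace ℝ ι)) := by
  have := memLp_sq_norm_stdGaussian (ι := ι).integrable_sq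
  simpa [← pow_mul] using this

lemma integral_norm_pow_four_stdGaussian :
    ∫ x, ‖x‖ ^ 4 ∂(stdGaussian (EuclideanSpace ℝ ι)) =
      Fintype.card ι * sqVariance + (Fintype.card ι : ℝ) ^ 2 := by
  have h := variance_eq_sub (memLp_sq_norm_stdGaussian (ι := ι))
  rw [variance_sq_norm_stdGaussian] at h
  simp only [Pi.pow_apply, ← pow_mul, integral_sq_norm_stdGaussian] at h
  linarith

lemma memLp_norm_stdGaussian :
    MemLp (fun x => ‖x‖) 2 (stdGaussian (EuclideanSpace ℝ ι)) :=
  (memLp_two_iff_integrable_sq (by fun_prop)).2 (memLp_sq_norm_stdGaussian.integrable (by norm_num))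

/-- The variance of the norm is nonnegative. -/
lemma integral_norm_stdGaussian_le :
    ∫ x, ‖x‖ ∂(stdGaussian (EuclideanSpace ℝ ι)) ≤ Real.sqrt (Fintype.card ι) := by
  apply Real.le_sqrt_of_sq_le
  have h := variance_eq_sub (memLp_norm_stdGaussian (ι := ι))
  have h' := variance_nonneg (fun x => ‖x‖) (stdGaussian (EuclideanSpace ℝ ι))
  simp only [Pi.pow_apply, integral_sq_norm_stdGaussian] at h
  linarith

/-- From `‖x‖² - n = (‖x‖ - √n)(‖x‖ + √n)` and `‖x‖ + √n ≥ √n`, fluctuations of the norm are at most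
those of `‖x‖²` divided by `√n`. The bound is independent of the dimension, which is what makes the
hinge error `O(1/L)`. -/
lemma integral_sq_norm_sub_sqrt_le [Nonempty ι] :
    ∫ x, (‖x‖ - Real.sqrt (Fintype.card ι)) ^ 2 ∂(stdGaussian (EuclideanSpace ℝ ι)) ≤
      sqVariance := by
  have hn : (0 : ℝ) < Fintype.card ι := by exact_mod_cast Fintype.card_pos
  have h := variance_sq_norm_stdGaussian (ι := ι)
  rw [variance_eq_integral (by fun_prop), integral_sq_norm_stdGaussian] at h
  have hi : Integrable (fun x => (‖x‖ ^ 2 - (Fintype.card ι : ℝ)) ^ 2)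
      (stdGaussian (EuclideanSpace ℝ ι)) :=
    (memLp_sq_norm_stdGaussian.sub (memLp_const _)).integrable_sq
  calc ∫ x, (‖x‖ - Real.sqrt (Fintype.card ι)) ^ 2 ∂(stdGaussian (EuclideanSpace ℝ ι))
      ≤ ∫ x, (‖x‖ ^ 2 - (Fintype.card ι : ℝ)) ^ 2 / Fintype.card ι
          ∂(stdGaussian (EuclideanSpace ℝ ι)) := by
        refine integral_mono ((memLp_norm_stdGaussian.sub (memLp_const _)).integrable_sq)
          (hi.div_const _) fun x => ?_
        simp only
        rw [le_div_iff₀ hn]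
        have hs := Real.sq_sqrt hn.le
        have hs0 := Real.sqrt_nonneg (Fintype.card ι : ℝ)
        generalize Real.sqrt (Fintype.card ι : ℝ) = s at *
        rw [← hs]
        have hx := norm_nonneg x
        have : (‖x‖ ^ 2 - s ^ 2) ^ 2 = (‖x‖ - s) ^ 2 * (‖x‖ + s) ^ 2 := by ring
        rw [this]
        gcongr
        linarith
    _ = sqVariance := by rw [integral_div, h]; field_simp

end Moments

/-! ### Independence of blocks, hinge and norm -/

section Independence

variable {M L : ℕ}

/-- The joint law is `(U ⊗ W) ⊗ Y`; reassociating it gives `U ⊗ (W ⊗ Y)`. -/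
lemma indepFun_prodMk_right {Ω α β δ : Type*} [MeasurableSpace Ω] [MeasurableSpace α]
    [MeasurableSpace β] [MeasurableSpace δ] {μ : Measure Ω} [IsProbabilityMeasure μ]
    {U : Ω → α} {W : Ω → β} {Y : Ω → δ} (hU : Measurable U) (hW : Measurable W)
    (hY : Measurable Y) (hUW : IndepFun U W μ) (hUWY : IndepFun (fun ω => (U ω, W ω)) Y μ) :
    IndepFun U (fun ω => (W ω, Y ω)) μ := by
  have hWY : IndepFun W Y μ := hUWY.comp (φ := Prod.snd) measurable_snd measurable_id
  rw [indepFun_iff_map_prod_eq_prod_map_map (by fun_prop) (by fun_prop)] at hUW hUWY hWY ⊢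
  have := Measure.isProbabilityMeasure_map (μ := μ) hU.aemeasurable
  have := Measure.isProbabilityMeasure_map (μ := μ) hW.aemeasurable
  have := Measure.isProbabilityMeasure_map (μ := μ) hY.aemeasurable
  calc μ.map (fun ω => (U ω, (W ω, Y ω)))
      = (μ.map fun ω => ((U ω, W ω), Y ω)).map MeasurableEquiv.prodAssoc := by
        rw [Measure.map_map MeasurableEquiv.prodAssoc.measurable (by fun_prop)]
        rfl
    _ = _ := by rw [hUWY, hUW, Measure.prodAssoc_prod, ← hWY]

@[fun_prop]
lemma measurable_block (i : Fin M) : Measurable fun g : Grad M L => block g i := by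
  unfold block; fun_prop

lemma map_block_stdGaussian (i : Fin M) :
    (stdGaussian (Grad M L)).map (fun g => block g i) = stdGaussian (EuclideanSpace ℝ (Fin L)) := by
  have hm := measurable_block (L := L) i
  have := Measure.isProbabilityMeasure_map (μ := stdGaussian (Grad M L)) hm.aemeasurable
  apply Measure.ext_of_charFun
  ext t
  rw [charFun_apply, integral_map hm.aemeasurable (by fun_prop)]
  -- The adjoint of taking block `i` extends `t` by zero and is an isometry, so the characteristic
  -- functions agree.
  let u : Grad M L := WithLp.toLp 2 fun p => if p.1 = i then t p.2 else 0
  have h1 : ∀ g : Grad M L, inner ℝ (block g i) t = inner ℝ g u := by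
    intro g
    simp [PiLp.inner_apply, u, block, Fintype.sum_prod_type]
  have h2 : ‖u‖ ^ 2 = ‖t‖ ^ 2 := by
    simp only [EuclideanSpace.norm_sq_eq, u, Fintype.sum_prod_type]
    rw [Finset.sum_eq_single i] <;> simp +contextual
  simp_rw [h1]
  rw [← charFun_apply, charFun_stdGaussian, charFun_stdGaussian]
  norm_cast
  rw [h2]

lemma iIndepFun_apply_stdGaussian {ι : Type*} [Fintype ι] :
    iIndepFun (fun (i : ι) (x : EuclideanSpace ℝ ι) => x i) (stdGaussian (EuclideanSpace ℝ ι)) := by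
  rw [iIndepFun_iff_map_fun_eq_pi_map fun i => by fun_prop]
  have h1 : ∀ i, (stdGaussian (EuclideanSpace ℝ ι)).map (fun x => x i) = gaussianReal 0 1 := by
    intro i
    rw [← map_toLp_measurePreserving.map_eq, Measure.map_map (by fun_prop) (by fun_prop)]
    exact (measurePreserving_eval (fun _ : ι => gaussianReal 0 1) i).map_eq
  simp_rw [h1]
  rw [← map_toLp_measurePreserving.map_eq, Measure.map_map (by fun_prop) (by fun_prop)]
  exact Measure.map_id

lemma block_normalized (g : Grad M L) (i : Fin M) :
    block (normalized g) i = ‖g‖⁻¹ • block g i := by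
  ext j
  simp [block, normalized]

lemma sq_norm_eq_sum_block (g : Grad M L) : ‖g‖ ^ 2 = ∑ i, ‖block g i‖ ^ 2 := by
  simp [EuclideanSpace.norm_sq_eq, block, Fintype.sum_prod_type]

lemma hinge_apply (g : Grad M L) (i : Fin M) : hinge g i = ‖g‖⁻¹ * ‖block g i‖ := by
  simp [hinge, block_normalized, norm_smul]

lemma normalized_smul {E : Type*} [NormedAddCommGroup E] [NormedSpace ℝ E] {c : ℝ} (hc : 0 ≤ c)
    (hx : c ≠ 0) (x : E) : normalized (c • x) = normalized x := by
  simp [normalized, norm_smul, abs_of_nonneg hc, smul_smul]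
  congr 1
  field_simp

lemma normBlock_eq (g : Grad M L) (i : Fin M) : normBlock g i = normalized (block g i) := by
  rcases eq_or_ne g 0 with rfl | hg
  · simp [normBlock, block, normalized]
  · rw [normBlock, block_normalized, normalized_smul (by positivity)]
    simpa using hg

/-- Each normalized block is independent of the hinge vector. -/
lemma indepFun_normBlock_hinge [NeZero L] (i : Fin M) :
    IndepFun (fun g : Grad M L => normBlock g i) hinge (stdGaussian (Grad M L)) := by
  classical
  -- `X` is block `i` and `Y` holds all other entries. The hinge is a function of `(‖X‖, Y)`, while
  -- the normalized block is the direction of `X`, independent of both.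
  let X : Grad M L → EuclideanSpace ℝ (Fin L) := fun g => block g i
  let Y : Grad M L → Fin M × Fin L → ℝ := fun g p => if p.1 = i then 0 else g p
  have hX : Measurable X := measurable_block i
  have hY : Measurable Y := by
    refine measurable_pi_lambda _ fun p => ?_
    by_cases h : p.1 = i <;> simp only [Y, h, if_true, if_false] <;> fun_prop
  have hXY : IndepFun X Y (stdGaussian (Grad M L)) := by
    have h := iIndepFun_apply_stdGaussian.indepFun_finset
      (Finset.univ.filter fun p : Fin M × Fin L => p.1 = i)
      (Finset.univ.filter fun p : Fin M × Fin L => p.1 ≠ i)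
      (Finset.disjoint_filter_filter_not _ _ _) (fun p => by fun_prop)
    refine h.comp (φ := fun x => (WithLp.toLp 2 fun j => x ⟨(i, j), by simp⟩ :
        EuclideanSpace ℝ (Fin L)))
      (ψ := fun y p => if hp : p.1 = i then 0 else y ⟨p, by simpa using hp⟩)
      ?_ (measurable_pi_lambda _ fun p => ?_)|>.congr ?_ ?_
    · fun_prop
    · by_cases hp : p.1 = i <;> simp only [hp, dite_true, dite_false] <;> fun_prop
    · exact Eventually.of_forall fun g => rfl
    · exact Eventually.of_forall fun g => by ext p; simp [Y]
  have hab : IndepFun (normalized ∘ X) ((fun v => ‖v‖) ∘ X) (stdGaussian (Grad M L)) := by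
    have h := indepFun_normalized_norm (E := EuclideanSpace ℝ (Fin L))
    rw [← map_block_stdGaussian (M := M) i] at h
    rw [indepFun_iff_measure_inter_preimage_eq_mul] at h ⊢
    intro s t hs ht
    have hs' := measurable_normalized hs
    have ht' := measurable_norm (α := EuclideanSpace ℝ (Fin L)) ht
    have := h s t hs ht
    rwa [Measure.map_apply hX (hs'.inter ht'), Measure.map_apply hX hs',
      Measure.map_apply hX ht'] at this
  have h := indepFun_prodMk_right (measurable_normalized.comp hX) (measurable_norm.comp hX) hY hab
    (hXY.comp (φ := fun x => (normalized x, ‖x‖)) (by fun_prop) measurable_id)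
  let n : ℝ × (Fin M × Fin L → ℝ) → Fin M → ℝ := fun y k =>
    if k = i then y.1 else ‖(WithLp.toLp 2 fun j => y.2 (k, j) : EuclideanSpace ℝ (Fin L))‖
  have hn : ∀ k, Measurable fun y => n y k := by
    intro k
    by_cases hk : k = i <;> simp only [n, hk, if_true, if_false] <;> fun_prop
  refine (h.comp measurable_id (ψ := fun y => WithLp.toLp 2 fun k =>
    (Real.sqrt (∑ k, n y k ^ 2))⁻¹ * n y k) ?_).congr ?_ ?_
  · fun_prop
  · exact Eventually.of_forall fun g => by simp [X, normBlock_eq]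
  · refine Eventually.of_forall fun g => ?_
    have : ∀ k, n (‖X g‖, Y g) k = ‖block g k‖ := by
      intro k
      by_cases hk : k = i <;> simp [n, hk, X, Y, block]
    ext k
    simp [this, hinge_apply, ← sq_norm_eq_sum_block]

/-- The norm is independent of the direction. -/
lemma indepFun_norm_normalized_grad [NeZero L] [NeZero M] :
    IndepFun (fun g : Grad M L => ‖g‖) normalized (stdGaussian (Grad M L)) :=
  indepFun_normalized_norm.symm

end Independence

/-! ### Existence of positive and even codebooks; chordal distance -/

section Codebooks

variable {n : ℕ}

lemma eq_zero_of_neg_eq_self {a : EuclideanSpace ℝ (Fin n)} (h : -a = a) : a = 0 := by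
  ext i
  have := congrArg (fun v : EuclideanSpace ℝ (Fin n) => v i) h
  simp only [PiLp.neg_apply, PiLp.zero_apply] at this ⊢
  linarith

/-- Supplies spare codewords with which codebooks are padded to exactly the prescribed size. The
witnesses are the normalized vectors `(k + 1, 1, …, 1)`, told apart by the ratio of their first two
coordinates. -/
lemma infinite_setOf_unit_pos (hn : 2 ≤ n) :
    {c : EuclideanSpace ℝ (Fin n) | ‖c‖ = 1 ∧ ∀ i, 0 < c i}.Infinite := by
  let i₀ : Fin n := ⟨0, by omega⟩
  let i₁ : Fin n := ⟨1, by omega⟩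
  have h01 : i₁ ≠ i₀ := by simp [i₀, i₁]
  let u : ℕ → EuclideanSpace ℝ (Fin n) := fun k =>
    WithLp.toLp 2 fun i => if i = i₀ then (k : ℝ) + 1 else 1
  have hu : ∀ k i, 0 < u k i := by
    intro k i
    by_cases h : i = i₀ <;> simp [u, h]
    positivity
  have hu0 : ∀ k, 0 < ‖u k‖ := fun k => by
    rw [norm_pos_iff]
    intro h
    have := hu k i₀
    simp [h] at this
  refine Set.infinite_of_injective_forall_mem (f := fun k => normalized (u k)) ?_ ?_
  · intro k l hkl
    have e : ∀ k, normalized (u k) i₀ / normalized (u k) i₁ = (k : ℝ) + 1 := by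
      intro k
      have := (hu0 k).ne'
      simp only [normalized, PiLp.smul_apply, smul_eq_mul]
      rw [mul_div_mul_left _ _ (inv_ne_zero this)]
      simp [u, h01]
    have h1 := e k
    have h2 := e l
    simp only at hkl
    rw [hkl, h2] at h1
    have h3 : (k : ℝ) = l := by linarith
    exact_mod_cast h3
  · intro k
    refine ⟨?_, fun i => ?_⟩
    · simp [normalized, norm_smul, (hu0 k).ne']
    · simp only [normalized, PiLp.smul_apply, smul_eq_mul]
      exact mul_pos (inv_pos.2 (hu0 k)) (hu k i)

lemma exists_positive_codebook (hn : 2 ≤ n) (b : ℕ) {e : EuclideanSpace ℝ (Fin n)}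
    (he : ‖e‖ = 1) (he' : ∀ i, 0 < e i) : ∃ C, IsGrassmannian b C ∧ IsPositive C ∧ e ∈ C := by
  classical
  obtain ⟨t, ht, htc⟩ := ((infinite_setOf_unit_pos hn).sdiff
    (Set.finite_singleton e)).exists_subset_card_eq (2 ^ b - 1)
  have hmem : ∀ c ∈ t, (‖c‖ = 1 ∧ ∀ i, 0 < c i) ∧ c ≠ e := fun c hc => ht hc
  have hpos : 0 < 2 ^ b := by positivity
  refine ⟨insert e t, ⟨?_, ?_⟩, ?_, Finset.mem_insert_self _ _⟩
  · rw [Finset.card_insert_of_notMem fun h => (hmem e h).2 rfl, htc]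
    omega
  · simp only [Finset.mem_insert, forall_eq_or_imp]
    exact ⟨he, fun c hc => (hmem c hc).1.1⟩
  · simp only [IsPositive, Finset.mem_insert, forall_eq_or_imp]
    exact ⟨he', fun c hc => (hmem c hc).1.2⟩

/-- A greedy choice of one vector from each antipodal pair that meets `A`; this is the candidate for
`C⁺`. -/
lemma exists_antipodal_free_cover (A : Finset (EuclideanSpace ℝ (Fin n)))
    (hA : ∀ a ∈ A, ‖a‖ = 1) : ∃ P : Finset (EuclideanSpace ℝ (Fin n)), P.card ≤ A.card ∧
      (∀ p ∈ P, ‖p‖ = 1 ∧ -p ∉ P) ∧ ∀ a ∈ A, a ∈ P ∨ -a ∈ P := by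
  classical
  induction A using Finset.induction_on with
  | empty => exact ⟨∅, by simp⟩
  | insert a A ha ih =>
    simp only [Finset.mem_insert, forall_eq_or_imp] at hA
    obtain ⟨P, h1, h2, h3⟩ := ih hA.2
    rw [Finset.card_insert_of_notMem ha]
    by_cases hP : a ∈ P ∨ -a ∈ P
    · refine ⟨P, by omega, h2, ?_⟩
      simp only [Finset.mem_insert, forall_eq_or_imp]
      exact ⟨hP, h3⟩
    · push Not at hP
      refine ⟨insert a P, (Finset.card_insert_le _ _).trans (by omega), ?_, ?_⟩
      · have ha0 : -a ≠ a := by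
          intro h
          have : a = 0 := eq_zero_of_neg_eq_self h
          simp [this] at hA
        simp only [Finset.mem_insert, forall_eq_or_imp, not_or]
        refine ⟨⟨hA.1, ha0, hP.2⟩, fun p hp => ⟨(h2 p hp).1, fun h => ?_, (h2 p hp).2⟩⟩
        rw [← h, neg_neg] at hP
        exact hP.2 hp
      · simp only [Finset.mem_insert, forall_eq_or_imp]
        exact ⟨.inl (.inl trivial), fun b hb => (h3 b hb).imp .inr .inr⟩

lemma exists_antipodal_free_superset (hn : 2 ≤ n) (P : Finset (EuclideanSpace ℝ (Fin n)))
    (hP : ∀ p ∈ P, ‖p‖ = 1 ∧ -p ∉ P) {m : ℕ} (hm : P.card ≤ m) :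
    ∃ P' : Finset (EuclideanSpace ℝ (Fin n)), P ⊆ P' ∧ P'.card = m ∧
      ∀ p ∈ P', ‖p‖ = 1 ∧ -p ∉ P' := by
  classical
  induction m, hm using Nat.le_induction with
  | base => exact ⟨P, subset_rfl, rfl, hP⟩
  | succ m hm ih =>
    obtain ⟨Q, hPQ, hQc, hQ⟩ := ih
    obtain ⟨a, ⟨ha, -⟩, haQ⟩ := ((infinite_setOf_unit_pos hn).sdiff
      (Q ∪ Q.image fun c => -c).finite_toSet).nonempty
    simp only [Finset.coe_union, Finset.coe_image, Set.mem_union, SetLike.mem_coe, Set.mem_image,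
      not_or, not_exists, not_and] at haQ
    refine ⟨insert a Q, hPQ.trans (Finset.subset_insert _ _), ?_, ?_⟩
    · rw [Finset.card_insert_of_notMem haQ.1, hQc]
    · have ha0 : -a ≠ a := by
        intro h
        have : a = 0 := eq_zero_of_neg_eq_self h
        simp [this] at ha
      simp only [Finset.mem_insert, forall_eq_or_imp, not_or]
      refine ⟨⟨ha, ha0, fun h => haQ.2 _ h (neg_neg a)⟩,
        fun p hp => ⟨(hQ p hp).1, haQ.2 p hp, (hQ p hp).2⟩⟩

/-- Closing under sign doubles the size, so one bit of the `k + 1` pays for evenness and `k` bits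
remain for free codewords. -/
lemma exists_even_codebook (hn : 2 ≤ n) (k : ℕ) (A : Finset (EuclideanSpace ℝ (Fin n)))
    (hA : ∀ a ∈ A, ‖a‖ = 1) (hc : A.card ≤ 2 ^ k) :
    ∃ C, IsGrassmannian (k + 1) C ∧ IsEven C ∧ A ⊆ C := by
  classical
  obtain ⟨P, h1, h2, h3⟩ := exists_antipodal_free_cover A hA
  obtain ⟨Q, hPQ, hQc, hQ⟩ := exists_antipodal_free_superset hn P h2 (h1.trans hc)
  have hdisj : Disjoint Q (Q.image fun c => -c) := by
    rw [Finset.disjoint_left]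
    intro p hp h
    obtain ⟨q, hq, rfl⟩ := Finset.mem_image.1 h
    exact (hQ q hq).2 hp
  refine ⟨Q ∪ Q.image fun c => -c, ⟨?_, ?_⟩, ?_, ?_⟩
  · rw [Finset.card_union_of_disjoint hdisj, Finset.card_image_of_injective _ neg_injective, hQc]
    ring
  · intro c hc
    rcases Finset.mem_union.1 hc with h | h
    · exact (hQ c h).1
    · obtain ⟨q, hq, rfl⟩ := Finset.mem_image.1 h
      simpa using (hQ q hq).1
  · unfold IsEven
    convert (⟨Q, hdisj, rfl⟩ : ∃ P : Finset (EuclideanSpace ℝ (Fin n)),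
      Disjoint P (P.image fun c => -c) ∧
        Q ∪ (Q.image fun c => -c) = P ∪ P.image fun c => -c)
  · intro a ha
    rcases h3 a ha with h | h
    · exact Finset.mem_union_left _ (hPQ h)
    · exact Finset.mem_union_right _ (Finset.mem_image.2 ⟨-a, hPQ h, neg_neg a⟩)

/-- The hypothesis `‖x‖ ≤ 1` rather than equality admits the default value `normalized 0 = 0`. -/
lemma sq_chordalDist {x c : EuclideanSpace ℝ (Fin n)} (hx : ‖x‖ ≤ 1) (hc : ‖c‖ = 1) :
    chordalDist x c ^ 2 = 1 - inner ℝ x c ^ 2 := by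
  have h := abs_real_inner_le_norm x c
  rw [hc, mul_one] at h
  rw [chordalDist, Real.sq_sqrt, sq_abs]
  rw [sub_nonneg, sq_le_one_iff_abs_le_one, abs_abs]
  exact h.trans hx

lemma iInf_sq_chordalDist_le {C : Finset (EuclideanSpace ℝ (Fin n))}
    {c : EuclideanSpace ℝ (Fin n)} (hc : c ∈ C) (x : EuclideanSpace ℝ (Fin n)) :
    ⨅ c : C, chordalDist x c ^ 2 ≤ chordalDist x c ^ 2 :=
  ciInf_le (f := fun c : C => chordalDist x c ^ 2)
    ⟨0, by rintro _ ⟨c, rfl⟩; positivity⟩ ⟨c, hc⟩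

lemma iInf_sq_chordalDist_nonneg (C : Finset (EuclideanSpace ℝ (Fin n)))
    (x : EuclideanSpace ℝ (Fin n)) : 0 ≤ ⨅ c : C, chordalDist x c ^ 2 :=
  Real.iInf_nonneg fun _ => by positivity

end Codebooks

/-! ### Volume of chordal caps -/

section Caps

open Module

variable {E : Type*} [NormedAddCommGroup E] [InnerProductSpace ℝ E] [FiniteDimensional ℝ E]
  [MeasurableSpace E] [BorelSpace E]

/-- The codewords in the unit ball whose direction is within squared chordal distance `x` of `s`. -/
def chordalCap (s : E) (x : ℝ) : Set E := {v | 1 - inner ℝ s (normalized v) ^ 2 ≤ x}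

/-- A lower bound for the volume of a double cone in the unit ball. -/
lemma volume_chordalCap_ge {s : E} (hs : ‖s‖ = 1) (hn : 2 ≤ finrank ℝ E) {x : ℝ} (hx0 : 0 < x)
    (hx1 : x < 1) :
    ENNReal.ofReal (Real.sqrt (1 - x) / (2 * finrank ℝ E) *
      ((1 - 1 / finrank ℝ E) * Real.sqrt x) ^ (finrank ℝ E - 1)) *
        volume (Metric.ball (0 : E) 1) ≤ volume (Metric.ball 0 1 ∩ chordalCap s x) := by
  set n := finrank ℝ E with hndef
  have hn' : (2 : ℝ) ≤ n := by exact_mod_cast hn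
  set c := Real.sqrt (1 - x)
  have hc0 : 0 < c := Real.sqrt_pos.2 (by linarith)
  have hc2 : c ^ 2 = 1 - x := Real.sq_sqrt (by linarith)
  set m : ℝ := 1 - 1 / n with hm
  have hinv : 1 / (n : ℝ) ≤ 1 / 2 := one_div_le_one_div_of_le (by norm_num) hn'
  have hinv0 : 0 < 1 / (n : ℝ) := by positivity
  have hm0 : 0 < m := by linarith
  have hm1 : m < 1 := by linarith
  set a := m * Real.sqrt x
  have ha0 : 0 < a := mul_pos hm0 (Real.sqrt_pos.2 hx0)
  have ha2 : a ^ 2 = m ^ 2 * x := by rw [mul_pow, Real.sq_sqrt hx0.le]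
  set b := c / (2 * n)
  have hb : b = c * (1 - m) / 2 := by simp only [b, hm]; field_simp; ring
  have hss : inner ℝ s s = 1 := by simp [hs]
  -- `T` scales by `b` along `s` and by `a` orthogonally to `s`, so its determinant is `b * a ^ (n -
  -- 1)`. Shifted by `p`, the image of the ball is an ellipsoid with heights between `c * m` and `c`
  -- and radius `a = m√x`. It lies in the cone because `a / (c * m) = √x / √(1 - x)`, and in the
  -- unit ball because `c² + a² ≤ 1`.
  let T : E →ₗ[ℝ] E := a • LinearMap.transvection (innerSL ℝ s : E →ₗ[ℝ] ℝ) (((b - a) / a) • s)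
  have hT : ∀ v, T v = a • v + ((b - a) * inner ℝ s v) • s := by
    intro v
    simp only [T, LinearMap.smul_apply, LinearMap.transvection.apply, smul_add, smul_smul]
    congr 2
    simp
    field_simp
  have hdet : LinearMap.det T = b * a ^ (n - 1) := by
    simp only [T, LinearMap.det_smul, LinearMap.transvection.det]
    rw [← hndef, ← Nat.sub_add_cancel (show 1 ≤ n by omega), pow_succ]
    simp [hs]
    field_simp
    ring
  let p : E := (c * (1 + m) / 2) • s
  have hsub : (fun v => p + v) '' (T '' Metric.ball 0 1) ⊆ Metric.ball 0 1 ∩ chordalCap s x := by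
    rintro _ ⟨_, ⟨v, hv, rfl⟩, rfl⟩
    simp only [Metric.mem_ball, dist_zero_right] at hv
    set z₀ : ℝ := inner ℝ s v with hz₀
    have hz : |z₀| ≤ ‖v‖ := by simpa [hs] using abs_real_inner_le_norm s v
    have hz' := abs_lt.1 (hz.trans_lt hv)
    set w := p + T v with hw
    set z := c * (1 + m) / 2 + b * z₀ with hzdef
    have hwz : inner ℝ s w = z := by
      rw [hw, hT, inner_add_right, inner_add_right, inner_smul_right, inner_smul_right,
        inner_smul_right, hss, ← hz₀]
      ring
    have hww : ‖w‖ ^ 2 = z ^ 2 + a ^ 2 * (‖v‖ ^ 2 - z₀ ^ 2) := by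
      have h1 : w = z • s + a • (v - z₀ • s) := by
        rw [hw, hT, ← hz₀]
        simp only [p, smul_sub, smul_smul, hzdef]
        module
      have h2 : inner ℝ s (v - z₀ • s) = 0 := by
        rw [inner_sub_right, inner_smul_right, hss, ← hz₀]; ring
      have h3 : ‖v - z₀ • s‖ ^ 2 = ‖v‖ ^ 2 - z₀ ^ 2 := by
        rw [norm_sub_sq_real, inner_smul_right, real_inner_comm, ← hz₀, norm_smul, hs]
        simp
        ring
      rw [h1, norm_add_sq_real, inner_smul_left, inner_smul_right, h2, norm_smul, norm_smul, hs,
        ← h3]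
      simp [mul_pow]
    have hzc : z < c := by
      rw [hzdef, hb]
      linarith [mul_lt_mul_of_pos_left hz'.2 (mul_pos hc0 (sub_pos.2 hm1))]
    have hzl : c * m ≤ z := by
      rw [hzdef, hb]
      linarith [mul_lt_mul_of_pos_left hz'.1 (mul_pos hc0 (sub_pos.2 hm1))]
    have hz0 : 0 < z := (mul_pos hc0 hm0).trans_le hzl
    have hw2 : ‖w‖ ^ 2 ≤ z ^ 2 + a ^ 2 := by
      rw [hww]
      have : a ^ 2 * (‖v‖ ^ 2 - z₀ ^ 2) ≤ a ^ 2 * 1 := by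
        gcongr
        linarith [sq_nonneg z₀, pow_le_one₀ (n := 2) (norm_nonneg v) hv.le]
      linarith
    have hwpos : 0 < ‖w‖ := by
      rw [norm_pos_iff]
      rintro h
      rw [h, inner_zero_right] at hwz
      exact hz0.ne hwz
    constructor
    · simp only [Metric.mem_ball, dist_zero_right]
      have h1 : ‖w‖ ^ 2 < 1 := by
        have h3 : z ^ 2 < c ^ 2 := by gcongr
        have h4 : m ^ 2 * x ≤ 1 * x := by
          gcongr
          exact pow_le_one₀ hm0.le hm1.le
        linarith
      exact (sq_lt_one_iff₀ (norm_nonneg _)).1 h1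
    · simp only [chordalCap, Set.mem_ofPred_eq, normalized, inner_smul_right]
      rw [hwz, mul_pow, inv_pow]
      have h5 : (1 - x) * ‖w‖ ^ 2 ≤ z ^ 2 := by
        have h6 : (c * m) ^ 2 ≤ z ^ 2 := by gcongr
        rw [mul_pow, hc2] at h6
        have h7 : (1 - x) * ‖w‖ ^ 2 ≤ (1 - x) * (z ^ 2 + a ^ 2) :=
          mul_le_mul_of_nonneg_left hw2 (by linarith)
        rw [ha2] at h7
        linarith [mul_le_mul_of_nonneg_left h6 hx0.le]
      have h8 : 1 - x ≤ (‖w‖ ^ 2)⁻¹ * z ^ 2 := by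
        rw [← div_eq_inv_mul, le_div_iff₀ (by positivity)]
        exact h5
      linarith
  calc _ = volume ((fun v => p + v) '' (T '' Metric.ball 0 1)) := by
        rw [Set.image_add_left, measure_preimage_add, Measure.addHaar_image_linearMap, hdet,
          abs_of_nonneg (by positivity)]
    _ ≤ _ := measure_mono hsub

end Caps

/-! ### Random coding for the normalized blocks -/

section RandomCoding

open Module

variable {E : Type*} [NormedAddCommGroup E] [InnerProductSpace ℝ E] [FiniteDimensional ℝ E]
  [MeasurableSpace E] [BorelSpace E]

lemma measurableSet_chordalCap_prod (x : ℝ) :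
    MeasurableSet {p : E × E | p.2 ∈ chordalCap p.1 x} := by
  simp only [chordalCap, Set.mem_ofPred_eq]
  refine measurableSet_le ?_ measurable_const
  have := measurable_normalized (E := E)
  fun_prop

/-- Random coding: if every cap has probability at least `F`, then some codebook of `K` codewords
leaves a point uncovered with probability at most `(1 - F) ^ K`. -/
lemma exists_codewords_measure_uncovered_le {Ω : Type*} [MeasurableSpace Ω] {μ : Measure Ω}
    [IsProbabilityMeasure μ] {ν : Measure E} [IsProbabilityMeasure ν] {X : Ω → E}
    (hX : Measurable X) {x F : ℝ}
    (hF : ∀ᵐ ω ∂μ, F ≤ ν.real (chordalCap (X ω) x)) (K : ℕ) :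
    ∃ c : Fin K → E, μ.real {ω | ∀ j, c j ∉ chordalCap (X ω) x} ≤ Real.exp (-(K * F)) := by
  let B : Set (Ω × (Fin K → E)) := {p | ∀ j, p.2 j ∉ chordalCap (X p.1) x}
  have hB : MeasurableSet B := by
    simp only [B, Set.ofPred_forall]
    refine MeasurableSet.iInter fun j => ?_
    exact ((measurableSet_chordalCap_prod x).preimage
      (f := fun p : Ω × (Fin K → E) => (X p.1, p.2 j)) (by fun_prop)).compl
  have hcap : ∀ s : E, MeasurableSet (chordalCap s x) := fun s =>
    (measurableSet_chordalCap_prod x).preimage (f := fun v => (s, v)) (by fun_prop)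
  set π := Measure.pi fun _ : Fin K => ν
  have hsec : ∀ᵐ ω ∂μ, π (Prod.mk ω ⁻¹' B) ≤ ENNReal.ofReal (Real.exp (-(K * F))) := by
    filter_upwards [hF] with ω hω
    have h1 : Prod.mk ω ⁻¹' B = Set.univ.pi fun _ : Fin K => (chordalCap (X ω) x)ᶜ := by
      ext c
      simp [B]
    have h2 : ν (chordalCap (X ω) x)ᶜ ≤ ENNReal.ofReal (Real.exp (-F)) := by
      rw [← ofReal_measureReal, probReal_compl_eq_one_sub (hcap _)]
      refine ENNReal.ofReal_le_ofReal ?_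
      linarith [Real.add_one_le_exp (-F)]
    rw [h1, Measure.pi_pi, Finset.prod_const, Finset.card_univ, Fintype.card_fin]
    refine (pow_le_pow_left' h2 K).trans ?_
    rw [← ENNReal.ofReal_pow (Real.exp_pos _).le, ← Real.exp_nat_mul]
    simp
  -- By Tonelli, the uncovered probability averaged over random codebooks obeys the bound proved for
  -- each source point; some codebook does no worse than the average.
  have hprod : ∫⁻ c, μ ((fun ω => (ω, c)) ⁻¹' B) ∂π ≤ ENNReal.ofReal (Real.exp (-(K * F))) := by
    rw [← Measure.prod_apply_symm hB, Measure.prod_apply hB]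
    refine (lintegral_mono_ae hsec).trans ?_
    simp
  obtain ⟨c, hc⟩ := exists_le_lintegral (μ := π)
    (f := fun c => μ ((fun ω => (ω, c)) ⁻¹' B)) (measurable_measure_prodMk_right hB).aemeasurable
  refine ⟨c, ?_⟩
  rw [measureReal_def]
  exact ENNReal.toReal_le_of_le_ofReal (Real.exp_pos _).le (hc.trans hprod)

/-- The uniform distribution on the unit ball gives a lower bound for the probability of a cap. -/
lemma cond_ball_chordalCap_ge {s : E} (hs : ‖s‖ = 1) (hn : 2 ≤ finrank ℝ E) {x : ℝ} (hx0 : 0 < x)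
    (hx1 : x < 1) :
    Real.sqrt (1 - x) / (2 * finrank ℝ E) *
      ((1 - 1 / finrank ℝ E) * Real.sqrt x) ^ (finrank ℝ E - 1) ≤
        (volume[|Metric.ball (0 : E) 1]).real (chordalCap s x) := by
  have h := volume_chordalCap_ge hs hn hx0 hx1
  have : Nontrivial E := nontrivial_of_finrank_pos (R := ℝ) (by omega)
  have hpos : volume (Metric.ball (0 : E) 1) ≠ 0 :=
    (Metric.measure_ball_pos _ _ one_pos).ne'
  have htop : volume (Metric.ball (0 : E) 1) ≠ ⊤ := measure_ball_lt_top.ne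
  rw [measureReal_def, ← ENNReal.ofReal_le_iff_le_toReal (measure_ne_top _ _),
    cond_apply measurableSet_ball, ← ENNReal.mul_le_iff_le_inv]
  · rwa [mul_comm]
  · exact hpos
  · exact htop

variable {n : ℕ} {Ω : Type*} [MeasurableSpace Ω] {μ : Measure Ω} [IsProbabilityMeasure μ]
  {X : Ω → EuclideanSpace ℝ (Fin n)}

/-- The squared distance is at most `x` on covered points and at most 1 elsewhere. -/
lemma chordalDistortion_le_add (hX : Measurable X) (hX1 : ∀ ω, ‖X ω‖ ≤ 1)
    {C : Finset (EuclideanSpace ℝ (Fin n))} (hC : ∀ c ∈ C, ‖c‖ = 1) (hCn : C.Nonempty) {K : ℕ}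
    {c : Fin K → EuclideanSpace ℝ (Fin n)} (hc : ∀ j, c j ≠ 0 → normalized (c j) ∈ C) {x : ℝ}
    (hx0 : 0 ≤ x) (hx1 : x < 1) :
    chordalDistortion μ X C ≤ x + μ.real {ω | ∀ j, c j ∉ chordalCap (X ω) x} := by
  set B := {ω | ∀ j, c j ∉ chordalCap (X ω) x}
  have hB : MeasurableSet B := by
    simp only [B, Set.ofPred_forall]
    refine MeasurableSet.iInter fun j => ?_
    exact ((measurableSet_chordalCap_prod x).preimage
      (f := fun ω => (X ω, c j)) (by fun_prop)).compl
  have hint : Integrable (fun ω => x + B.indicator 1 ω) μ :=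
    (integrable_const _).add ((integrable_const 1).indicator hB)
  calc chordalDistortion μ X C ≤ ∫ ω, (x + B.indicator 1 ω) ∂μ := by
        refine integral_mono_of_nonneg
          (Eventually.of_forall fun ω => iInf_sq_chordalDist_nonneg _ _) hint
          (Eventually.of_forall fun ω => ?_)
        by_cases hω : ω ∈ B
        · obtain ⟨a, ha⟩ := hCn
          have h1 := iInf_sq_chordalDist_le ha (X ω)
          rw [sq_chordalDist (hX1 ω) (hC a ha)] at h1
          simp only [Set.indicator_of_mem hω, Pi.one_apply]
          linarith [sq_nonneg (inner ℝ (X ω) a)]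
        · simp only [B, Set.mem_ofPred_eq, not_forall, not_not] at hω
          obtain ⟨j, hj⟩ := hω
          have hmem : normalized (c j) ∈ C := by
            -- A zero codeword covers nothing: its default direction 0 is at squared distance 1,
            -- which exceeds `x`.
            refine hc j fun h => ?_
            simp only [chordalCap, Set.mem_ofPred_eq, h, normalized, smul_zero,
              inner_zero_right] at hj
            norm_num at hj
            linarith
          have h1 := iInf_sq_chordalDist_le hmem (X ω)
          rw [sq_chordalDist (hX1 ω) (hC _ hmem)] at h1
          have h2 : (0 : ℝ) ≤ B.indicator 1 ω := Set.indicator_nonneg (fun _ _ => zero_le_one) _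
          have h3 : 1 - inner ℝ (X ω) (normalized (c j)) ^ 2 ≤ x := hj
          simp only
          linarith
    _ = x + μ.real B := by
        rw [integral_add (integrable_const _) ((integrable_const 1).indicator hB),
          integral_indicator_one hB]
        simp

/-- There is an even codebook of `k + 1` bits with small distortion, for every source on the unit
sphere. -/
lemma exists_even_codebook_chordalDistortion_le (hn : 2 ≤ n) (hX : Measurable X)
    (hX1 : ∀ ω, ‖X ω‖ ≤ 1) (hX2 : ∀ᵐ ω ∂μ, ‖X ω‖ = 1) (k : ℕ) :
    ∃ C, IsGrassmannian (k + 1) C ∧ IsEven C ∧ chordalDistortion μ X C ≤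
      ((1 - 1 / (n : ℝ))⁻¹ * ((n : ℝ) ^ 3 / 2 ^ k) ^ (1 / ((n : ℝ) - 1))) ^ 2 + 1 / n := by
  classical
  -- The radius `y` solves `((1 - 1/n) * y) ^ (n - 1) = n³ / 2 ^ k`. The cap probability is then at
  -- least `n / (2 * 2 ^ k)` when `√(1 - y²) ≥ 1/n`, so `2 ^ k` codewords leave at most `exp (-n/2)
  -- ≤ 1/n` uncovered.
  set y := (1 - 1 / (n : ℝ))⁻¹ * ((n : ℝ) ^ 3 / 2 ^ k) ^ (1 / ((n : ℝ) - 1)) with hy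
  have hn' : (2 : ℝ) ≤ n := by exact_mod_cast hn
  have hm0 : 0 < 1 - 1 / (n : ℝ) := by
    have : 1 / (n : ℝ) ≤ 1 / 2 := one_div_le_one_div_of_le (by norm_num) hn'
    linarith
  have hy0 : 0 < y := by positivity
  -- If `y² ≥ 1 - 1/n`, the claimed bound is at least 1 and any codebook meets it, so the codewords
  -- are then irrelevant.
  have key : ∃ c : Fin (2 ^ k) → EuclideanSpace ℝ (Fin n), y ^ 2 < 1 - 1 / n →
      μ.real {ω | ∀ j, c j ∉ chordalCap (X ω) (y ^ 2)} ≤ 1 / n := by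
    by_cases hy1 : y ^ 2 < 1 - 1 / n
    swap
    · exact ⟨0, fun h => absurd h hy1⟩
    have hn0 : 0 < 1 / (n : ℝ) := by positivity
    have hprob : IsProbabilityMeasure
        (volume[|Metric.ball (0 : EuclideanSpace ℝ (Fin n)) 1]) := by
      refine cond_isProbabilityMeasure_of_finite ?_ measure_ball_lt_top.ne
      exact (Metric.measure_ball_pos _ _ one_pos).ne'
    set F := Real.sqrt (1 - y ^ 2) / (2 * n) * ((1 - 1 / n) * Real.sqrt (y ^ 2)) ^ (n - 1)
    obtain ⟨c, hc⟩ := exists_codewords_measure_uncovered_le (μ := μ)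
      (ν := volume[|Metric.ball (0 : EuclideanSpace ℝ (Fin n)) 1]) hX (x := y ^ 2)
      (by
        filter_upwards [hX2] with ω hω
        have := cond_ball_chordalCap_ge hω (by simpa using hn) (x := y ^ 2) (by positivity)
          (by linarith)
        simpa only [finrank_euclideanSpace_fin] using this) (2 ^ k)
    refine ⟨c, fun _ => hc.trans ?_⟩
    have h1 : ((1 - 1 / n) * Real.sqrt (y ^ 2)) ^ (n - 1) = (n : ℝ) ^ 3 / 2 ^ k := by
      rw [Real.sqrt_sq hy0.le, hy, ← mul_assoc, mul_inv_cancel₀ hm0.ne', one_mul,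
        ← Real.rpow_natCast, ← Real.rpow_mul (by positivity), Nat.cast_sub (by omega)]
      have : (n : ℝ) - 1 ≠ 0 := by linarith
      rw [Nat.cast_one, one_div_mul_cancel this, Real.rpow_one]
    have h2 : 1 / (n : ℝ) ≤ Real.sqrt (1 - y ^ 2) := by
      apply Real.le_sqrt_of_sq_le
      have : 1 / (n : ℝ) ≤ 1 := by rw [div_le_one (by positivity)]; linarith
      nlinarith
    have h3 : (n : ℝ) / 2 ≤ ((2 ^ k : ℕ) : ℝ) * F := by
      simp only [F]
      rw [h1]
      push_cast
      calc (n : ℝ) / 2 = 2 ^ k * (1 / n / (2 * n) * (n ^ 3 / 2 ^ k)) := by field_simp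
        _ ≤ _ := by gcongr
    have h4 : Real.log n ≤ n / 2 := by
      have h5 : Real.log ((n : ℝ) / 2) ≤ n / 2 - 1 := Real.log_le_sub_one_of_pos (by positivity)
      rw [Real.log_div (by positivity) (by norm_num)] at h5
      linarith [Real.log_two_lt_d9]
    calc Real.exp (-(((2 ^ k : ℕ) : ℝ) * F)) ≤ Real.exp (-Real.log n) := by
          apply Real.exp_le_exp.2; linarith
      _ = 1 / n := by rw [Real.exp_neg, Real.exp_log (by positivity), one_div]
  obtain ⟨c, hc⟩ := key
  obtain ⟨C, hC1, hC2, hC3⟩ := exists_even_codebook hn k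
    ((Finset.univ.filter fun j => c j ≠ 0).image fun j => normalized (c j)) (by
      intro a ha
      obtain ⟨j, hj, rfl⟩ := Finset.mem_image.1 ha
      have : c j ≠ 0 := (Finset.mem_filter.1 hj).2
      simp [normalized, norm_smul, this])
    (Finset.card_image_le.trans ((Finset.card_filter_le _ _).trans (by simp)))
  refine ⟨C, hC1, hC2, ?_⟩
  have hCn : C.Nonempty := by
    rw [← Finset.card_pos, hC1.1]; positivity
  by_cases hy1 : y ^ 2 < 1 - 1 / n
  · have hn0 : 0 < 1 / (n : ℝ) := by positivity
    have := chordalDistortion_le_add (μ := μ) hX hX1 hC1.2 hCn (c := c) (fun j hj => hC3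
      (Finset.mem_image.2 ⟨j, by simpa using hj, rfl⟩)) (x := y ^ 2) (by positivity) (by linarith)
    linarith [hc hy1]
  · have : chordalDistortion μ X C ≤ 1 := by
      obtain ⟨a, ha⟩ := hCn
      calc chordalDistortion μ X C ≤ ∫ _, 1 ∂μ := by
            refine integral_mono_of_nonneg
              (Eventually.of_forall fun ω => iInf_sq_chordalDist_nonneg _ _) (integrable_const _)
              (Eventually.of_forall fun ω => ?_)
            have h1 := iInf_sq_chordalDist_le ha (X ω)
            rw [sq_chordalDist (hX1 ω) (hC1.2 a ha)] at h1
            simp only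
            linarith [sq_nonneg (inner ℝ (X ω) a)]
        _ = 1 := by simp
    linarith

end RandomCoding

/-! ### Rate-distortion lower bound for finite codebooks -/

section RateDistortion

variable {ι : Type*} [Fintype ι]

lemma integral_stdGaussian_eq {E : Type*} [NormedAddCommGroup E] [InnerProductSpace ℝ E]
    [FiniteDimensional ℝ E] [MeasurableSpace E] [BorelSpace E] (f : E → ℝ) :
    ∫ x, f x ∂(stdGaussian E) = ∫ x, gaussianDensity E x * f x := by
  rw [stdGaussian_eq_withDensity, integral_withDensity_eq_integral_toReal_smul
    measurable_gaussianDensity.ennreal_ofReal (by simp)]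
  simp_rw [ENNReal.toReal_ofReal (gaussianDensity_pos _).le, smul_eq_mul]

lemma integrable_stdGaussian_iff {E : Type*} [NormedAddCommGroup E] [InnerProductSpace ℝ E]
    [FiniteDimensional ℝ E] [MeasurableSpace E] [BorelSpace E] (f : E → ℝ) :
    Integrable f (stdGaussian E) ↔ Integrable fun x => gaussianDensity E x * f x := by
  rw [stdGaussian_eq_withDensity, integrable_withDensity_iff_integrable_smul'
    measurable_gaussianDensity.ennreal_ofReal (by simp)]
  simp_rw [ENNReal.toReal_ofReal (gaussianDensity_pos _).le, smul_eq_mul]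

/-- The tilt replaces the standard Gaussian by an unnormalized one of variance `D` centred at `c`,
whose mass does not depend on `c`. -/
lemma gaussianDensity_mul_exp {D : ℝ} (c x : EuclideanSpace ℝ ι) :
    gaussianDensity _ x * Real.exp (‖x‖ ^ 2 / 2 - ‖x - c‖ ^ 2 / (2 * D)) =
      (2 * Real.pi) ^ (-(Fintype.card ι / 2 : ℝ)) *
        Real.exp (-(1 / (2 * D)) * ‖x - c‖ ^ 2) := by
  rw [gaussianDensity, mul_assoc, ← Real.exp_add, finrank_euclideanSpace]
  congr 2
  ring

lemma integrable_exp_sub_stdGaussian {D : ℝ} (hD : 0 < D) (c : EuclideanSpace ℝ ι) :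
    Integrable (fun x => Real.exp (‖x‖ ^ 2 / 2 - ‖x - c‖ ^ 2 / (2 * D)))
      (stdGaussian (EuclideanSpace ℝ ι)) := by
  rw [integrable_stdGaussian_iff]
  simp_rw [gaussianDensity_mul_exp]
  exact ((integrable_exp_neg_mul_sq_norm (b := 1 / (2 * D)) (by positivity)).comp_sub_right
    c).const_mul _

lemma integral_exp_sub_stdGaussian {D : ℝ} (hD : 0 < D) (c : EuclideanSpace ℝ ι) :
    ∫ x, Real.exp (‖x‖ ^ 2 / 2 - ‖x - c‖ ^ 2 / (2 * D)) ∂(stdGaussian (EuclideanSpace ℝ ι)) =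
      D ^ (Fintype.card ι / 2 : ℝ) := by
  have hpi := Real.pi_pos
  rw [integral_stdGaussian_eq]
  simp_rw [gaussianDensity_mul_exp]
  rw [integral_const_mul,
    integral_sub_right_eq_self (fun x : EuclideanSpace ℝ ι => Real.exp (-(1 / (2 * D)) * ‖x‖ ^ 2)),
    GaussianFourier.integral_rexp_neg_mul_sq_norm (by positivity), finrank_euclideanSpace]
  have : Real.pi / (1 / (2 * D)) = (2 * Real.pi) * D := by field_simp
  rw [this, Real.mul_rpow (by positivity) hD.le, ← mul_assoc, ← Real.rpow_add (by positivity)]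
  simp

lemma integrable_sq_norm_sub_of_finite_range {Q : EuclideanSpace ℝ ι → EuclideanSpace ℝ ι}
    (hQ : Measurable Q) {S : Finset (EuclideanSpace ℝ ι)} (hS : ∀ x, Q x ∈ S) :
    Integrable (fun x => ‖x - Q x‖ ^ 2) (stdGaussian (EuclideanSpace ℝ ι)) := by
  have h1 : Integrable (fun x => 2 * ‖x‖ ^ 2 + 2 * ∑ c ∈ S, ‖c‖ ^ 2)
      (stdGaussian (EuclideanSpace ℝ ι)) :=
    ((memLp_sq_norm_stdGaussian.integrable (by norm_num)).const_mul 2).add (integrable_const _)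
  refine h1.mono' (by fun_prop) (Eventually.of_forall fun x => ?_)
  rw [Real.norm_of_nonneg (by positivity)]
  have h2 : ‖Q x‖ ^ 2 ≤ ∑ c ∈ S, ‖c‖ ^ 2 :=
    Finset.single_le_sum (f := fun c => ‖c‖ ^ 2) (fun _ _ => by positivity) (hS x)
  have h3 : ‖x - Q x‖ ^ 2 ≤ (‖x‖ + ‖Q x‖) ^ 2 := by gcongr; exact norm_sub_le _ _
  linarith [sq_nonneg (‖x‖ - ‖Q x‖)]

/-- The tilt at `Q x` is at most the sum `G` of the tilts over all codewords, and `G` has mean `exp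
a`, with `exp a` the codebook size times `D ^ (n/2)`. Integrating `1 + t ≤ exp t` at the exponent of
the tilt minus `a` gives a mean exponent of at most `a`. -/
lemma rate_distortion_aux {Q : EuclideanSpace ℝ ι → EuclideanSpace ℝ ι}
    (hQ : Measurable Q) {S : Finset (EuclideanSpace ℝ ι)} (hS : ∀ x, Q x ∈ S) {D : ℝ}
    (hD : 0 < D) :
    (Fintype.card ι : ℝ) / 2 -
      (∫ x, ‖x - Q x‖ ^ 2 ∂(stdGaussian (EuclideanSpace ℝ ι))) / (2 * D) ≤
        Real.log S.card + Fintype.card ι / 2 * Real.log D := by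
  have hK : 0 < (S.card : ℝ) := by
    exact_mod_cast Finset.card_pos.2 ⟨_, hS 0⟩
  have hDn : 0 < D ^ (Fintype.card ι / 2 : ℝ) := by positivity
  set a := Real.log (S.card * D ^ (Fintype.card ι / 2 : ℝ)) with ha
  have haval : a = Real.log S.card + Fintype.card ι / 2 * Real.log D := by
    rw [ha, Real.log_mul hK.ne' hDn.ne', Real.log_rpow hD]
  have hea : Real.exp a = S.card * D ^ (Fintype.card ι / 2 : ℝ) :=
    Real.exp_log (mul_pos hK hDn)
  let G : EuclideanSpace ℝ ι → ℝ := fun x =>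
    ∑ c ∈ S, Real.exp (‖x‖ ^ 2 / 2 - ‖x - c‖ ^ 2 / (2 * D))
  have hG : Integrable G (stdGaussian (EuclideanSpace ℝ ι)) :=
    integrable_finsetSum _ fun c _ => integrable_exp_sub_stdGaussian hD c
  have hGi : ∫ x, G x ∂(stdGaussian (EuclideanSpace ℝ ι)) = Real.exp a := by
    rw [integral_finsetSum _ fun c _ => integrable_exp_sub_stdGaussian hD c, hea]
    simp_rw [integral_exp_sub_stdGaussian hD]
    simp
  have hi1 : Integrable (fun x => ‖x‖ ^ 2 / 2) (stdGaussian (EuclideanSpace ℝ ι)) :=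
    (memLp_sq_norm_stdGaussian.integrable (by norm_num)).div_const 2
  have hi2 := (integrable_sq_norm_sub_of_finite_range hQ hS).div_const (2 * D)
  have hmono : ∫ x, (‖x‖ ^ 2 / 2 - ‖x - Q x‖ ^ 2 / (2 * D)) ∂(stdGaussian (EuclideanSpace ℝ ι)) ≤
      ∫ x, (a - 1 + Real.exp (-a) * G x) ∂(stdGaussian (EuclideanSpace ℝ ι)) := by
    refine integral_mono (hi1.sub hi2) ((integrable_const _).add (hG.const_mul _)) fun x => ?_
    have h1 : Real.exp (‖x‖ ^ 2 / 2 - ‖x - Q x‖ ^ 2 / (2 * D)) ≤ G x :=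
      Finset.single_le_sum (f := fun c => Real.exp (‖x‖ ^ 2 / 2 - ‖x - c‖ ^ 2 / (2 * D)))
        (fun _ _ => (Real.exp_pos _).le) (hS x)
    have h2 := Real.add_one_le_exp (-a + (‖x‖ ^ 2 / 2 - ‖x - Q x‖ ^ 2 / (2 * D)))
    rw [Real.exp_add] at h2
    have h3 := mul_le_mul_of_nonneg_left h1 (Real.exp_pos (-a)).le
    simp only
    linarith
  rw [integral_sub hi1 hi2, integral_div, integral_div, integral_sq_norm_stdGaussian,
    integral_add (integrable_const _) (hG.const_mul _), integral_const_mul, hGi,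
    ← Real.exp_add] at hmono
  simp at hmono
  linarith

/-- The lower bound of rate-distortion theory for the standard Gaussian distribution and a
quantizer with finitely many codewords. -/
theorem rate_distortion_lower_bound [Nonempty ι] {Q : EuclideanSpace ℝ ι → EuclideanSpace ℝ ι}
    (hQ : Measurable Q) {S : Finset (EuclideanSpace ℝ ι)} (hS : ∀ x, Q x ∈ S) :
    0 < ∫ x, ‖x - Q x‖ ^ 2 ∂(stdGaussian (EuclideanSpace ℝ ι)) ∧
      -(2 / Fintype.card ι * Real.log S.card) ≤
        Real.log ((∫ x, ‖x - Q x‖ ^ 2 ∂(stdGaussian (EuclideanSpace ℝ ι))) / Fintype.card ι) := by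
  set m := ∫ x, ‖x - Q x‖ ^ 2 ∂(stdGaussian (EuclideanSpace ℝ ι))
  have hn : (0 : ℝ) < Fintype.card ι := by exact_mod_cast Fintype.card_pos
  have hm : 0 < m := by
    refine lt_of_le_of_ne (integral_nonneg fun _ => by positivity) fun h => ?_
    -- At this `D` the right-hand side vanishes, so zero distortion would give `n/2 ≤ 0`.
    have h1 := rate_distortion_aux hQ hS
      (Real.exp_pos (-(2 / Fintype.card ι * Real.log S.card)))
    change _ - m / _ ≤ _ at h1
    rw [← h, Real.log_exp, zero_div] at h1
    have : (Fintype.card ι : ℝ) / 2 * -(2 / Fintype.card ι * Real.log S.card) =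
      -Real.log S.card := by field_simp
    rw [this] at h1
    linarith
  refine ⟨hm, ?_⟩
  -- Taking `D` to be the distortion per coordinate makes the left-hand side zero.
  have h1 := rate_distortion_aux hQ hS (div_pos hm hn)
  change _ - m / _ ≤ _ at h1
  have h2 : m / (2 * (m / Fintype.card ι)) = Fintype.card ι / 2 := by field_simp
  rw [h2, sub_self] at h1
  have h3 : -(2 / Fintype.card ι * Real.log S.card) = 2 / Fintype.card ι * -Real.log S.card := by
    ring
  rw [h3, div_mul_eq_mul_div, div_le_iff₀ hn]
  linarith

end RateDistortion

/-! ### Measurability and number of values of the quantizer -/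

section Quantizer

variable {M L bρ bs bh : ℕ} (q : HierarchicalQuantizer M L bρ bs bh)

@[fun_prop]
lemma measurable_hinge : Measurable (hinge : Grad M L → _) := by
  unfold hinge; fun_prop

@[fun_prop]
lemma measurable_normBlock (i : Fin M) : Measurable fun g : Grad M L => normBlock g i := by
  unfold normBlock; fun_prop

lemma HierarchicalQuantizer.measurable_quantize : Measurable q.quantize := by
  have h1 := q.Qρ_nearest.1
  have h2 := q.Qs_nearest.1
  have h3 := q.Qh_nearest.1
  have h4 : ∀ i : Fin M, Measurable fun g : Grad M L => q.Qs (normBlock g i) :=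
    fun i => h2.comp (measurable_normBlock i)
  have h5 : Measurable fun g : Grad M L => q.Qh (hinge g) := h3.comp measurable_hinge
  unfold HierarchicalQuantizer.quantize
  fun_prop

lemma card_uniformCodebook_le (r : ℝ) (b : ℕ) : (uniformCodebook r b).card ≤ 2 ^ b := by
  unfold uniformCodebook
  exact Finset.card_image_le.trans (by simp)

open Classical in
/-- All the values that the quantizer can take. -/
noncomputable def HierarchicalQuantizer.codewords : Finset (Grad M L) :=
  (uniformCodebook (rhoMax M L) bρ ×ˢ q.Ch ×ˢ Fintype.piFinset fun _ : Fin M => q.Cs).image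
    fun c => WithLp.toLp 2 fun p => c.1 * (c.2.1 p.1 * c.2.2 p.1 p.2)

lemma HierarchicalQuantizer.quantize_mem_codewords (g : Grad M L) : q.quantize g ∈ q.codewords := by
  refine Finset.mem_image.2 ⟨(q.Qρ ‖g‖, q.Qh (hinge g), fun i => q.Qs (normBlock g i)), ?_, rfl⟩
  simp only [Finset.mem_product, Fintype.mem_piFinset]
  exact ⟨(q.Qρ_nearest.2 _).1, (q.Qh_nearest.2 _).1, fun i => (q.Qs_nearest.2 _).1⟩

lemma HierarchicalQuantizer.card_codewords_le : q.codewords.card ≤ 2 ^ (bρ + M * bs + bh) := by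
  refine Finset.card_image_le.trans ?_
  rw [Finset.card_product, Finset.card_product, Fintype.card_piFinset, Finset.prod_const,
    Finset.card_univ, Fintype.card_fin, q.Cs_grassmannian.1, q.Ch_grassmannian.1]
  calc _ ≤ 2 ^ bρ * (2 ^ bh * (2 ^ bs) ^ M) := by gcongr; exact card_uniformCodebook_le _ _
    _ = _ := by ring

end Quantizer

/-! ### Nearest codewords and chordal distance -/

section Nearest

variable {n : ℕ} {C : Finset (EuclideanSpace ℝ (Fin n))}
  {Q : EuclideanSpace ℝ (Fin n) → EuclideanSpace ℝ (Fin n)}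

lemma IsNearest.inner_le (hQ : IsNearest C Q) (hC : ∀ c ∈ C, ‖c‖ = 1)
    (x : EuclideanSpace ℝ (Fin n)) {c : EuclideanSpace ℝ (Fin n)} (hc : c ∈ C) :
    inner ℝ x c ≤ inner ℝ x (Q x) := by
  obtain ⟨h1, h2⟩ := hQ.2 x
  have h3 := pow_le_pow_left₀ (norm_nonneg _) (h2 c hc) 2
  rw [norm_sub_sq_real, norm_sub_sq_real, hC _ h1, hC c hc] at h3
  linarith

lemma IsNearest.inner_le_one (hQ : IsNearest C Q) (hC : ∀ c ∈ C, ‖c‖ = 1)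
    {x : EuclideanSpace ℝ (Fin n)} (hx : ‖x‖ ≤ 1) : |inner ℝ x (Q x)| ≤ 1 := by
  have := abs_real_inner_le_norm x (Q x)
  rw [hC _ (hQ.2 x).1, mul_one] at this
  exact this.trans hx

/-- For `0 ≤ t ≤ 1`, `1 - t ≤ 1 - t²`. Chordal distance ignores signs, so `habs` is needed: it holds
for even codebooks, and for positive ones on nonnegative vectors. This is the origin of the `ln 2`
in `cGap`. -/
lemma IsNearest.one_sub_inner_le_iInf (hQ : IsNearest C Q) (hC : ∀ c ∈ C, ‖c‖ = 1)
    {x : EuclideanSpace ℝ (Fin n)} (hx : ‖x‖ ≤ 1)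
    (habs : ∀ c ∈ C, |inner ℝ x c| ≤ inner ℝ x (Q x)) :
    1 - inner ℝ x (Q x) ≤ ⨅ c : C, chordalDist x c ^ 2 := by
  have : Nonempty C := ⟨⟨_, (hQ.2 x).1⟩⟩
  refine le_ciInf fun c => ?_
  rw [sq_chordalDist hx (hC c c.2), ← sq_abs (inner ℝ x (c : EuclideanSpace ℝ (Fin n)))]
  have h1 := habs c c.2
  have h2 := (abs_le.1 (hQ.inner_le_one hC hx)).2
  have h0 := abs_nonneg (inner ℝ x (c : EuclideanSpace ℝ (Fin n)))
  have h3 := pow_le_pow_left₀ h0 h1 2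
  nlinarith

lemma IsEven.neg_mem (h : IsEven C) {c : EuclideanSpace ℝ (Fin n)} (hc : c ∈ C) : -c ∈ C := by
  classical
  obtain ⟨P, -, hP⟩ := h
  rw [hP] at hc ⊢
  rcases Finset.mem_union.1 hc with h | h
  · exact Finset.mem_union_right _ (Finset.mem_image_of_mem _ h)
  · obtain ⟨p, hp, rfl⟩ := Finset.mem_image.1 h
    exact Finset.mem_union_left _ (by simpa using hp)

lemma IsNearest.abs_inner_le_of_isEven (hQ : IsNearest C Q) (hC : ∀ c ∈ C, ‖c‖ = 1)
    (hCe : IsEven C) (x : EuclideanSpace ℝ (Fin n)) :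
    ∀ c ∈ C, |inner ℝ x c| ≤ inner ℝ x (Q x) := by
  intro c hc
  refine abs_le'.2 ⟨hQ.inner_le hC x hc, ?_⟩
  rw [← inner_neg_right]
  exact hQ.inner_le hC x (hCe.neg_mem hc)

lemma IsNearest.abs_inner_le_of_isPositive (hQ : IsNearest C Q) (hC : ∀ c ∈ C, ‖c‖ = 1)
    (hCp : IsPositive C) {x : EuclideanSpace ℝ (Fin n)} (hx : ∀ i, 0 ≤ x i) :
    ∀ c ∈ C, |inner ℝ x c| ≤ inner ℝ x (Q x) := by
  intro c hc
  rw [abs_of_nonneg]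
  · exact hQ.inner_le hC x hc
  · rw [PiLp.inner_apply]
    exact Finset.sum_nonneg fun i _ => by
      simpa using mul_nonneg (hCp c hc i).le (hx i)

lemma integrable_iInf_sq_chordalDist {Ω : Type*} [MeasurableSpace Ω] {μ : Measure Ω}
    [IsProbabilityMeasure μ] {X : Ω → EuclideanSpace ℝ (Fin n)} (hX : Measurable X)
    (hX1 : ∀ ω, ‖X ω‖ ≤ 1) (hC : ∀ c ∈ C, ‖c‖ = 1) (hCn : C.Nonempty) :
    Integrable (fun ω => ⨅ c : C, chordalDist (X ω) c ^ 2) μ := by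
  refine Integrable.of_bound (C := 1) ?_ (Eventually.of_forall fun ω => ?_)
  · refine (Measurable.iInf fun c => ?_).aestronglyMeasurable
    unfold chordalDist
    fun_prop
  · obtain ⟨c, hc⟩ := hCn
    rw [Real.norm_of_nonneg (iInf_sq_chordalDist_nonneg _ _)]
    refine (iInf_sq_chordalDist_le hc _).trans ?_
    rw [sq_chordalDist (hX1 ω) (hC c hc)]
    linarith [sq_nonneg (inner ℝ (X ω) c)]

end Nearest

/-! ### Scalar quantization of the norm -/

section UniformQuantizer

variable {r : ℝ} {b : ℕ} {Q : ℝ → ℝ}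

lemma IsNearest.nonneg_uniformCodebook (hQ : IsNearest (uniformCodebook r b) Q) (hr : 0 ≤ r)
    (x : ℝ) : 0 ≤ Q x := by
  have h := (hQ.2 x).1
  simp only [uniformCodebook, Finset.mem_image] at h
  obtain ⟨k, -, hk⟩ := h
  rw [← hk]
  positivity

lemma IsNearest.abs_sub_uniformCodebook_le (hQ : IsNearest (uniformCodebook r b) Q) (hr : 0 < r)
    {x : ℝ} (hx : 0 ≤ x) : |x - Q x| ≤ r / 2 ^ b / 2 + max (x - r) 0 := by
  have hb : (0 : ℝ) < 2 ^ b := by positivity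
  set w := r / 2 ^ b with hw
  have hw0 : 0 < w := by positivity
  have hwr : 2 ^ b * w = r := by rw [hw]; field_simp
  have hnear : ∀ k : ℕ, k < 2 ^ b → |x - Q x| ≤ |x - ((k : ℝ) + 1 / 2) * w| := fun k hk =>
    (hQ.2 x).2 _ (by
      classical
      simp only [uniformCodebook, Finset.mem_image, Finset.mem_range]
      exact ⟨k, hk, rfl⟩)
  rcases lt_or_ge x r with hxr | hxr
  · have h1 := Nat.floor_le (div_nonneg hx hw0.le)
    have h2 := Nat.lt_floor_add_one (x / w)
    rw [le_div_iff₀ hw0] at h1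
    rw [div_lt_iff₀ hw0] at h2
    have h3 : ⌊x / w⌋₊ < 2 ^ b := by
      rw [Nat.floor_lt (div_nonneg hx hw0.le), div_lt_iff₀ hw0]
      push_cast
      rwa [hwr]
    refine (hnear _ h3).trans (le_trans ?_ (le_add_of_nonneg_right (le_max_right _ _)))
    rw [abs_le]
    constructor <;> linarith
  -- Above the range, the comparison is with the last midpoint, half a step below `r`.
  · have h1 : ((2 ^ b - 1 : ℕ) : ℝ) = 2 ^ b - 1 := by
      rw [Nat.cast_sub Nat.one_le_two_pow]; simp
    refine (hnear (2 ^ b - 1) (Nat.sub_lt (by positivity) one_pos)).trans ?_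
    rw [h1, max_eq_left (by linarith), abs_of_nonneg]
    · linarith
    · linarith

/-- The overload is nonzero only for `x > r ≥ N`. The square of the first bound and `x` times the
second are both `x⁴ / N²`, so the fourth moment of the norm controls every overload term. -/
lemma max_sub_zero_le {x r N : ℝ} (hx : 0 ≤ x) (hN : 0 < N) (hNr : N ≤ r) :
    max (x - r) 0 ≤ x ^ 2 / N ∧ max (x - r) 0 ≤ x ^ 3 / N ^ 2 := by
  rcases le_or_gt x r with h | h
  · rw [max_eq_right (by linarith)]
    exact ⟨by positivity, by positivity⟩
  · rw [max_eq_left (by linarith)]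
    have hxN : N ≤ x := by linarith
    constructor
    · rw [le_div_iff₀ hN]
      nlinarith
    · rw [le_div_iff₀ (by positivity)]
      have : N ^ 2 ≤ x ^ 2 := by gcongr
      nlinarith [pow_pos hN 2]

end UniformQuantizer

/-! ### Upper bound for the mean squared error -/

section UpperBound

variable {M L bρ bs bh : ℕ} (q : HierarchicalQuantizer M L bρ bs bh)

lemma norm_normalized_le_one {E : Type*} [NormedAddCommGroup E] [NormedSpace ℝ E] (x : E) :
    ‖normalized x‖ ≤ 1 := by
  rcases eq_or_ne x 0 with rfl | h
  · simp [normalized]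
  · simp [normalized, norm_smul, h]

lemma norm_hinge_le_one (g : Grad M L) : ‖hinge g‖ ≤ 1 := by
  have h := norm_normalized_le_one g
  have h2 : ‖hinge g‖ ^ 2 = ‖normalized g‖ ^ 2 := by
    rw [sq_norm_eq_sum_block, EuclideanSpace.norm_sq_eq]
    simp [hinge]
  rwa [(sq_eq_sq₀ (norm_nonneg _) (norm_nonneg _)).1 h2]

lemma hinge_nonneg (g : Grad M L) (i : Fin M) : 0 ≤ hinge g i := by
  simp [hinge]

lemma norm_mul_hinge (g : Grad M L) (i : Fin M) : ‖g‖ * hinge g i = ‖block g i‖ := by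
  rcases eq_or_ne g 0 with rfl | h
  · have : block (0 : Grad M L) i = 0 := by ext j; simp [block]
    simp [this]
  · rw [hinge_apply, mul_inv_cancel_left₀ (by simpa using h)]

lemma block_eq_smul_normBlock (g : Grad M L) (i : Fin M) :
    block g i = ‖block g i‖ • normBlock g i := by
  rw [normBlock_eq, normalized]
  rcases eq_or_ne (block g i) 0 with h | h
  · simp [h]
  · rw [smul_inv_smul₀ (by simpa using h)]

/-- The part of the quantization error that depends only on the direction of the gradient. -/
noncomputable def HierarchicalQuantizer.directionError (g : Grad M L) : ℝ :=
  (1 - inner ℝ (hinge g) (q.Qh (hinge g))) +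
    ∑ i, hinge g i * q.Qh (hinge g) i *
      (1 - inner ℝ (normBlock g i) (q.Qs (normBlock g i)))

/-- Unit codewords give `‖ĝ‖ = ρ̂`, so `‖g - ĝ‖² = (ρ - ρ̂)² + 2ρρ̂(1 - cos)`, where the cosine of
the angle is `∑ hᵢ ĥᵢ ⟨sᵢ, ŝᵢ⟩`; the direction error is one minus this sum. -/
lemma HierarchicalQuantizer.sq_norm_sub_quantize (g : Grad M L) :
    ‖g - q.quantize g‖ ^ 2 = (‖g‖ - q.Qρ ‖g‖) ^ 2 +
      2 * (‖g‖ * q.Qρ ‖g‖ * q.directionError g) := by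
  have hh : ‖q.Qh (hinge g)‖ = 1 := q.Ch_grassmannian.2 _ (q.Qh_nearest.2 _).1
  have hs : ∀ i, ‖q.Qs (normBlock g i)‖ = 1 :=
    fun i => q.Cs_grassmannian.2 _ (q.Qs_nearest.2 _).1
  have h1 : ‖q.quantize g‖ ^ 2 = q.Qρ ‖g‖ ^ 2 := by
    have hb : ∀ i, ‖block (q.quantize g) i‖ ^ 2 = (q.Qρ ‖g‖ * q.Qh (hinge g) i) ^ 2 := by
      intro i
      have : block (q.quantize g) i = (q.Qρ ‖g‖ * q.Qh (hinge g) i) • q.Qs (normBlock g i) := by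
        ext j
        simp [block, HierarchicalQuantizer.quantize, mul_assoc]
      rw [this, norm_smul, hs, mul_one, Real.norm_eq_abs, sq_abs]
    have hh2 : ∑ i, q.Qh (hinge g) i ^ 2 = 1 := by
      have := EuclideanSpace.norm_sq_eq (q.Qh (hinge g))
      rw [hh] at this
      simpa using this.symm
    rw [sq_norm_eq_sum_block]
    simp_rw [hb, mul_pow]
    rw [← Finset.mul_sum, hh2, mul_one]
  have h2 : inner ℝ g (q.quantize g) = ∑ i, ‖g‖ * q.Qρ ‖g‖ * (hinge g i * q.Qh (hinge g) i *
      inner ℝ (normBlock g i) (q.Qs (normBlock g i))) := by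
    have h3 : ∀ i, ∑ j, g (i, j) * q.Qs (normBlock g i) j =
        ‖g‖ * hinge g i * inner ℝ (normBlock g i) (q.Qs (normBlock g i)) := by
      intro i
      rw [norm_mul_hinge]
      have : ∑ j, g (i, j) * q.Qs (normBlock g i) j =
          inner ℝ (block g i) (q.Qs (normBlock g i)) := by
        simp [PiLp.inner_apply, block, mul_comm]
      rw [this]
      conv_lhs => rw [block_eq_smul_normBlock g i]
      rw [real_inner_smul_left]
    rw [PiLp.inner_apply, Fintype.sum_prod_type]
    refine Finset.sum_congr rfl fun i _ => ?_
    have : ∀ j, inner ℝ (g (i, j)) (q.quantize g (i, j)) =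
        q.Qρ ‖g‖ * q.Qh (hinge g) i * (g (i, j) * q.Qs (normBlock g i) j) := by
      intro j
      simp [HierarchicalQuantizer.quantize]
      ring
    simp_rw [this]
    rw [← Finset.mul_sum, h3]
    ring
  have h4 : inner ℝ (hinge g) (q.Qh (hinge g)) = ∑ i, hinge g i * q.Qh (hinge g) i := by
    simp [PiLp.inner_apply, mul_comm]
  have h5 : q.directionError g = 1 - ∑ i, hinge g i * q.Qh (hinge g) i *
      inner ℝ (normBlock g i) (q.Qs (normBlock g i)) := by
    simp only [HierarchicalQuantizer.directionError, h4, mul_sub, mul_one, Finset.sum_sub_distrib]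
    ring
  rw [norm_sub_sq_real, h1, h2, h5, ← Finset.mul_sum]
  ring

lemma integral_sq_norm_grad :
    ∫ g, ‖g‖ ^ 2 ∂(stdGaussian (Grad M L)) = M * L := by
  rw [integral_sq_norm_stdGaussian]; simp

/-- The weights `w i = hᵢ ĥᵢ` are nonnegative, independent of the block errors, and sum to `⟨h, ĥ⟩ ≤
1`. The block errors therefore contribute `d` once, not `M` times. -/
lemma HierarchicalQuantizer.integral_directionError_le [NeZero L] {x d : ℝ}
    (hx : chordalDistortion (stdGaussian (Grad M L)) hinge q.Ch ≤ x)
    (hd : ∀ i, chordalDistortion (stdGaussian (Grad M L)) (fun g => normBlock g i) q.Cs ≤ d)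
    (hd0 : 0 ≤ d) : ∫ g, q.directionError g ∂(stdGaussian (Grad M L)) ≤ x + d := by
  set γ := stdGaussian (Grad M L)
  have hCh := q.Ch_grassmannian.2
  have hCs := q.Cs_grassmannian.2
  have hCp : ∀ g : Grad M L, ∀ i, 0 < q.Qh (hinge g) i :=
    fun g => q.Ch_positive _ (q.Qh_nearest.2 _).1
  have hs1 : ∀ (i : Fin M) (g : Grad M L), ‖normBlock g i‖ ≤ 1 :=
    fun i g => norm_normalized_le_one _
  let t : Fin M → Grad M L → ℝ := fun i g => 1 - inner ℝ (normBlock g i) (q.Qs (normBlock g i))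
  let w : Fin M → Grad M L → ℝ := fun i g => hinge g i * q.Qh (hinge g) i
  have hw0 : ∀ i g, 0 ≤ w i g := fun i g => mul_nonneg (hinge_nonneg g i) (hCp g i).le
  have hw_sum : ∀ g, ∑ i, w i g = inner ℝ (hinge g) (q.Qh (hinge g)) := by
    intro g
    simp [w, PiLp.inner_apply, mul_comm]
  have hh1 : ∀ g : Grad M L, |inner ℝ (hinge g) (q.Qh (hinge g))| ≤ 1 :=
    fun g => q.Qh_nearest.inner_le_one hCh (norm_hinge_le_one g)
  have hw1 : ∀ i g, w i g ≤ 1 := fun i g => by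
    refine le_trans ?_ (abs_le.1 (hh1 g)).2
    rw [← hw_sum]
    exact Finset.single_le_sum (f := fun i => w i g) (fun i _ => hw0 i g) (Finset.mem_univ i)
  have ht : ∀ i g, |1 - t i g| ≤ 1 := fun i g => by
    simpa [t] using q.Qs_nearest.inner_le_one hCs (hs1 i g)
  have hwm : ∀ i, Measurable (w i) := by
    intro i
    have := q.Qh_nearest.1.comp (measurable_hinge (M := M) (L := L))
    simp only [Function.comp_def] at this
    fun_prop
  have htm : ∀ i, Measurable (t i) := by
    intro i
    have := q.Qs_nearest.1.comp (measurable_normBlock (L := L) i)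
    simp only [Function.comp_def] at this
    fun_prop
  have hti : ∀ i, Integrable (t i) γ := fun i =>
    Integrable.of_bound (htm i).aestronglyMeasurable 2 (Eventually.of_forall fun g => by
      have := abs_le.1 (ht i g)
      rw [Real.norm_eq_abs, abs_le]
      constructor <;> linarith)
  have hwi : ∀ i, Integrable (w i) γ := fun i =>
    Integrable.of_bound (hwm i).aestronglyMeasurable 1 (Eventually.of_forall fun g => by
      rw [Real.norm_of_nonneg (hw0 i g)]
      exact hw1 i g)
  have hind : ∀ i, IndepFun (w i) (t i) γ := fun i => by
    refine (indepFun_normBlock_hinge i).symm.comp (φ := fun x => x i * q.Qh x i)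
      (ψ := fun s => 1 - inner ℝ s (q.Qs s)) ?_ ?_
    · have := q.Qh_nearest.1
      fun_prop
    · have := q.Qs_nearest.1
      fun_prop
  have hwti : ∀ i, Integrable (fun g => w i g * t i g) γ := fun i =>
    (hind i).integrable_mul (hwi i) (hti i)
  have h0i : Integrable (fun g : Grad M L => 1 - inner ℝ (hinge g) (q.Qh (hinge g))) γ :=
    (integrable_const _).sub (by
      simp_rw [← hw_sum]
      exact integrable_finsetSum _ fun i _ => hwi i)
  have e1 : ∫ g : Grad M L, (1 - inner ℝ (hinge g) (q.Qh (hinge g))) ∂γ ≤ x := by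
    refine le_trans (integral_mono h0i (integrable_iInf_sq_chordalDist measurable_hinge
      norm_hinge_le_one hCh ⟨_, (q.Qh_nearest.2 0).1⟩) fun g => ?_) hx
    exact q.Qh_nearest.one_sub_inner_le_iInf hCh (norm_hinge_le_one g)
      (q.Qh_nearest.abs_inner_le_of_isPositive hCh q.Ch_positive (hinge_nonneg g))
  have e2 : ∀ i, ∫ g, t i g ∂γ ≤ d := fun i => by
    refine le_trans (integral_mono (hti i) (integrable_iInf_sq_chordalDist
      (measurable_normBlock i) (hs1 i) hCs ⟨_, (q.Qs_nearest.2 0).1⟩) fun g => ?_) (hd i)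
    exact q.Qs_nearest.one_sub_inner_le_iInf hCs (hs1 i g)
      (q.Qs_nearest.abs_inner_le_of_isEven hCs q.Cs_even _)
  have e3 : ∀ i, ∫ g, w i g * t i g ∂γ ≤ (∫ g, w i g ∂γ) * d := fun i => by
    rw [(hind i).integral_fun_mul_eq_mul_integral (hwm i).aestronglyMeasurable
      (htm i).aestronglyMeasurable]
    exact mul_le_mul_of_nonneg_left (e2 i) (integral_nonneg (hw0 i))
  have e4 : ∑ i, ∫ g, w i g ∂γ ≤ 1 := by
    rw [← integral_finsetSum _ fun i _ => hwi i]
    calc _ ≤ ∫ _, (1 : ℝ) ∂γ := by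
          refine integral_mono (integrable_finsetSum _ fun i _ => hwi i) (integrable_const _)
            fun g => ?_
          simp only [hw_sum]
          exact (abs_le.1 (hh1 g)).2
      _ = 1 := by simp
  calc ∫ g, q.directionError g ∂γ
      = (∫ g : Grad M L, (1 - inner ℝ (hinge g) (q.Qh (hinge g))) ∂γ) +
          ∑ i, ∫ g, w i g * t i g ∂γ := by
        rw [← integral_finsetSum _ fun i _ => hwti i,
          ← integral_add h0i (integrable_finsetSum _ fun i _ => hwti i)]
        rfl
    _ ≤ x + ∑ i, (∫ g, w i g ∂γ) * d := add_le_add e1 (Finset.sum_le_sum fun i _ => e3 i)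
    _ ≤ x + 1 * d := by
        rw [← Finset.sum_mul]
        gcongr
    _ = x + d := by ring

lemma HierarchicalQuantizer.indepFun_directionError [NeZero M] [NeZero L] :
    IndepFun (fun g : Grad M L => ‖g‖ * q.Qρ ‖g‖) q.directionError (stdGaussian (Grad M L)) := by
  have hρ := q.Qρ_nearest.1
  have hh := q.Qh_nearest.1
  have hs := q.Qs_nearest.1
  let H : Grad M L → EuclideanSpace ℝ (Fin M) := fun f => WithLp.toLp 2 fun i => ‖block f i‖
  have hH : Measurable H := by fun_prop
  refine (indepFun_norm_normalized_grad (M := M) (L := L)).comp (φ := fun r => r * q.Qρ r)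
    (ψ := fun f => (1 - inner ℝ (H f) (q.Qh (H f))) + ∑ i, H f i * q.Qh (H f) i *
      (1 - inner ℝ (normalized (block f i)) (q.Qs (normalized (block f i))))) ?_ ?_
  · fun_prop
  · have h1 : ∀ i : Fin M, Measurable fun f : Grad M L => q.Qs (normalized (block f i)) :=
      fun i => hs.comp (by fun_prop)
    have h2 : Measurable fun f => q.Qh (H f) := hh.comp hH
    fun_prop

/-- By optimality, it suffices to use a positive codebook containing the constant unit vector `e`,
near which the hinge concentrates. The bound holds for every number of hinge bits. -/
lemma chordalDistortion_hinge_le [NeZero L] (hM : 2 ≤ M) :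
    chordalDistortion (stdGaussian (Grad M L)) hinge q.Ch ≤ sqVariance / L := by
  set γ := stdGaussian (Grad M L)
  have hM0 : (0 : ℝ) < M := by positivity
  have hL0 : (0 : ℝ) < L := by exact_mod_cast NeZero.pos L
  have : NeZero M := ⟨by omega⟩
  have hsM := Real.sqrt_pos.2 hM0
  have hsM2 := Real.sq_sqrt hM0.le
  let e : EuclideanSpace ℝ (Fin M) := WithLp.toLp 2 fun _ => (Real.sqrt M)⁻¹
  have he : ‖e‖ = 1 := by
    rw [← sq_eq_sq₀ (norm_nonneg _) zero_le_one, EuclideanSpace.norm_sq_eq]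
    simp [e, hM0.ne']
  obtain ⟨C, hC1, hC2, hC3⟩ := exists_positive_codebook hM bh he fun i => by simp [e, hM0]
  refine (q.Ch_optimal C hC1 hC2).trans ?_
  let f : Grad M L → ℝ := fun g => 1 - inner ℝ (hinge g) e ^ 2
  have hfm : Measurable f := by fun_prop
  have hf0 : ∀ g, 0 ≤ f g := fun g => by
    have := abs_real_inner_le_norm (hinge g) e
    rw [he, mul_one] at this
    have := sq_le_one_iff_abs_le_one _ |>.2 (this.trans (norm_hinge_le_one g))
    simp only [f]
    linarith
  have hfi : Integrable f γ :=
    Integrable.of_bound hfm.aestronglyMeasurable 1 (Eventually.of_forall fun g => by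
      rw [Real.norm_of_nonneg (hf0 g)]
      simp only [f]
      linarith [sq_nonneg (inner ℝ (hinge g) e)])
  have h1 : chordalDistortion γ hinge C ≤ ∫ g, f g ∂γ := by
    refine integral_mono (integrable_iInf_sq_chordalDist measurable_hinge
      norm_hinge_le_one hC1.2 ⟨e, hC3⟩) hfi fun g => ?_
    refine (iInf_sq_chordalDist_le hC3 _).trans (le_of_eq ?_)
    exact sq_chordalDist (norm_hinge_le_one g) he
  have hind : IndepFun (fun g : Grad M L => ‖g‖ ^ 2) f γ := by
    refine (indepFun_norm_normalized_grad (M := M) (L := L)).comp (φ := fun r => r ^ 2)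
      (ψ := fun v => 1 - inner ℝ (WithLp.toLp 2 fun i => ‖block v i‖) e ^ 2) ?_ ?_
    · fun_prop
    · fun_prop
  have hsq : Integrable (fun g => ‖g‖ ^ 2) γ :=
    memLp_sq_norm_stdGaussian.integrable (by norm_num)
  -- Independence of norm and direction permits multiplying by `‖g‖²`, which removes the
  -- normalization: `‖g‖² f` is the sum of squared deviations of the block norms from their mean, at
  -- most that from `√L`.
  have h2 : M * L * ∫ g, f g ∂γ = ∫ g, ‖g‖ ^ 2 * f g ∂γ := by
    rw [hind.integral_fun_mul_eq_mul_integral (by fun_prop) hfm.aestronglyMeasurable]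
    simp only [γ, integral_sq_norm_grad]
  have hblock : ∀ i : Fin M, Integrable (fun g : Grad M L => (‖block g i‖ - Real.sqrt L) ^ 2) γ ∧
      ∫ g, (‖block g i‖ - Real.sqrt L) ^ 2 ∂γ ≤ sqVariance := by
    intro i
    have hi : Integrable (fun x => (‖x‖ - Real.sqrt L) ^ 2)
        (stdGaussian (EuclideanSpace ℝ (Fin L))) :=
      ((memLp_norm_stdGaussian.sub (memLp_const _)).integrable_sq)
    have hm := integral_sq_norm_sub_sqrt_le (ι := Fin L)
    rw [Fintype.card_fin, ← map_block_stdGaussian (M := M) i,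
      integral_map (by fun_prop) (by fun_prop)] at hm
    rw [← map_block_stdGaussian (M := M) i, integrable_map_measure (by fun_prop) (by fun_prop)]
      at hi
    exact ⟨hi, hm⟩
  have h3 : ∫ g, ‖g‖ ^ 2 * f g ∂γ ≤ M * sqVariance := by
    calc ∫ g, ‖g‖ ^ 2 * f g ∂γ ≤ ∫ g, ∑ i, (‖block g i‖ - Real.sqrt L) ^ 2 ∂γ := by
          refine integral_mono (hind.integrable_mul hsq hfi)
            (integrable_finsetSum _ fun i _ => (hblock i).1) fun g => ?_
          have e1 : ‖g‖ * inner ℝ (hinge g) e = (Real.sqrt M)⁻¹ * ∑ i, ‖block g i‖ := by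
            simp only [PiLp.inner_apply, Finset.mul_sum, ← norm_mul_hinge g]
            refine Finset.sum_congr rfl fun i _ => ?_
            simp [e]
            ring
          have e2 : ‖g‖ ^ 2 * f g =
              ∑ i, ‖block g i‖ ^ 2 - (∑ i, ‖block g i‖) ^ 2 / M := by
            have : ‖g‖ ^ 2 * f g = ‖g‖ ^ 2 - (‖g‖ * inner ℝ (hinge g) e) ^ 2 := by
              simp only [f]; ring
            rw [this, e1, sq_norm_eq_sum_block, mul_pow, inv_pow, hsM2]
            ring
          have e3 : ∑ i, (‖block g i‖ - Real.sqrt L) ^ 2 = ∑ i, ‖block g i‖ ^ 2 -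
              2 * Real.sqrt L * ∑ i, ‖block g i‖ + M * Real.sqrt L ^ 2 := by
            simp only [sub_sq, Finset.sum_add_distrib, Finset.sum_sub_distrib, Finset.mul_sum]
            simp
            refine Finset.sum_congr rfl fun i _ => ?_
            ring
          simp only
          rw [e2, e3]
          have : 0 ≤ (∑ i, ‖block g i‖ - M * Real.sqrt L) ^ 2 / M := by positivity
          have e4 : (∑ i, ‖block g i‖ - M * Real.sqrt L) ^ 2 / M = (∑ i, ‖block g i‖) ^ 2 / M -
              2 * Real.sqrt L * ∑ i, ‖block g i‖ + M * Real.sqrt L ^ 2 := by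
            field_simp
            ring
          linarith
      _ = ∑ i, ∫ g, (‖block g i‖ - Real.sqrt L) ^ 2 ∂γ :=
          integral_finsetSum _ fun i _ => (hblock i).1
      _ ≤ ∑ _i : Fin M, sqVariance := Finset.sum_le_sum fun i _ => (hblock i).2
      _ = M * sqVariance := by simp
  refine h1.trans ?_
  rw [le_div_iff₀ hL0]
  rw [← h2] at h3
  have : (M : ℝ) * ((∫ g, f g ∂γ) * L) ≤ M * sqVariance := by linarith
  exact le_of_mul_le_mul_left this hM0

/-- Here `δ` bounds half a step of the norm quantizer. The terms `sqVariance + 1` bound `E‖g‖⁴ / N²`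
and come from overload. -/
theorem HierarchicalQuantizer.mse_le [NeZero L] (hM : 2 ≤ M) {d : ℝ} (hd0 : 0 ≤ d)
    (hd : ∀ i, chordalDistortion (stdGaussian (Grad M L)) (fun g => normBlock g i) q.Cs ≤ d) {δ : ℝ}
    (hδ : rhoMax M L / 2 ^ bρ / 2 ≤ δ) :
    q.mse ≤ 2 * δ ^ 2 + 2 * (sqVariance + 1) +
      2 * (M * L + δ * Real.sqrt (M * L) + (sqVariance + 1)) * (d + sqVariance / L) := by
  set γ := stdGaussian (Grad M L)
  have hV := sqVariance_nonneg
  have hM0 : (1 : ℝ) ≤ M := by exact_mod_cast (by omega : 1 ≤ M)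
  have hL0 : (1 : ℝ) ≤ L := by exact_mod_cast NeZero.one_le (n := L)
  have : NeZero M := ⟨by omega⟩
  set N : ℝ := M * L with hN
  have hN1 : 1 ≤ N := one_le_mul_of_one_le_of_one_le hM0 hL0
  have hNr : N ≤ rhoMax M L := le_add_of_nonneg_right (Real.sqrt_nonneg _)
  have hr0 : 0 < rhoMax M L := by linarith
  have hδ0 : 0 ≤ δ := le_trans (by positivity) hδ
  have hQ := q.Qρ_nearest
  have hQm := hQ.1
  have hQ0 : ∀ g : Grad M L, 0 ≤ q.Qρ ‖g‖ := fun g => hQ.nonneg_uniformCodebook hr0.le _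
  have hdist : ∀ g : Grad M L, |‖g‖ - q.Qρ ‖g‖| ≤ δ + max (‖g‖ - rhoMax M L) 0 := fun g =>
    (hQ.abs_sub_uniformCodebook_le hr0 (norm_nonneg g)).trans (by gcongr)
  have hmax := fun g : Grad M L => max_sub_zero_le (norm_nonneg g) (by linarith : 0 < N) hNr
  have hmax0 := fun g : Grad M L => le_max_right (‖g‖ - rhoMax M L) 0
  have hi1 : Integrable (fun g => ‖g‖) γ := memLp_norm_stdGaussian.integrable (by norm_num)
  have hi2 : Integrable (fun g => ‖g‖ ^ 2) γ :=
    memLp_sq_norm_stdGaussian.integrable (by norm_num)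
  have hi4 : Integrable (fun g => ‖g‖ ^ 4) γ := integrable_norm_pow_four_stdGaussian
  have hcard : (Fintype.card (Fin M × Fin L) : ℝ) = N := by simp [hN]
  have hI1 : ∫ g, ‖g‖ ∂γ ≤ Real.sqrt N := by
    have := integral_norm_stdGaussian_le (ι := Fin M × Fin L)
    rwa [hcard] at this
  have hI2 : ∫ g, ‖g‖ ^ 2 ∂γ = N := integral_sq_norm_grad
  have hI4 : (∫ g, ‖g‖ ^ 4 ∂γ) / N ^ 2 ≤ sqVariance + 1 := by
    have := integral_norm_pow_four_stdGaussian (ι := Fin M × Fin L)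
    rw [hcard] at this
    rw [this, div_le_iff₀ (by positivity)]
    nlinarith [mul_nonneg hV (by linarith : 0 ≤ N)]
  have hρb : ∀ g : Grad M L, (‖g‖ - q.Qρ ‖g‖) ^ 2 ≤ 2 * δ ^ 2 + 2 * (‖g‖ ^ 4 / N ^ 2) := by
    intro g
    have h1 := pow_le_pow_left₀ (abs_nonneg _) (hdist g) 2
    rw [sq_abs] at h1
    have h2 := pow_le_pow_left₀ (hmax0 g) (hmax g).1 2
    rw [div_pow, ← pow_mul] at h2
    norm_num at h2
    linarith [sq_nonneg (δ - max (‖g‖ - rhoMax M L) 0)]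
  have hUb : ∀ g : Grad M L, ‖g‖ * q.Qρ ‖g‖ ≤ ‖g‖ ^ 2 + δ * ‖g‖ + ‖g‖ ^ 4 / N ^ 2 := by
    intro g
    have h1 := (abs_le.1 (hdist g)).1
    have h2 : q.Qρ ‖g‖ ≤ ‖g‖ + (δ + ‖g‖ ^ 3 / N ^ 2) := by linarith [(hmax g).2]
    have h3 := mul_le_mul_of_nonneg_left h2 (norm_nonneg g)
    refine h3.trans (le_of_eq ?_)
    ring
  have hρbi : Integrable (fun g => 2 * δ ^ 2 + 2 * (‖g‖ ^ 4 / N ^ 2)) γ :=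
    (integrable_const _).add ((hi4.div_const _).const_mul _)
  have hUbi : Integrable (fun g => ‖g‖ ^ 2 + δ * ‖g‖ + ‖g‖ ^ 4 / N ^ 2) γ :=
    (hi2.add (hi1.const_mul _)).add (hi4.div_const _)
  have hρi : Integrable (fun g => (‖g‖ - q.Qρ ‖g‖) ^ 2) γ :=
    hρbi.mono' (by fun_prop) (Eventually.of_forall fun g => by
      rw [Real.norm_of_nonneg (by positivity)]; exact hρb g)
  have hU0 : ∀ g : Grad M L, 0 ≤ ‖g‖ * q.Qρ ‖g‖ := fun g => mul_nonneg (norm_nonneg g) (hQ0 g)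
  have hUi : Integrable (fun g => ‖g‖ * q.Qρ ‖g‖) γ :=
    hUbi.mono' (by fun_prop) (Eventually.of_forall fun g => by
      rw [Real.norm_of_nonneg (hU0 g)]; exact hUb g)
  have hρI : ∫ g, (‖g‖ - q.Qρ ‖g‖) ^ 2 ∂γ ≤ 2 * δ ^ 2 + 2 * (sqVariance + 1) := by
    refine (integral_mono hρi hρbi hρb).trans ?_
    rw [integral_add (integrable_const _) ((hi4.div_const _).const_mul _), integral_const,
      integral_const_mul, integral_div]
    simp
    linarith
  have hUI : ∫ g, ‖g‖ * q.Qρ ‖g‖ ∂γ ≤ N + δ * Real.sqrt N + (sqVariance + 1) := by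
    refine (integral_mono hUi hUbi hUb).trans ?_
    have hi21 : Integrable (fun g => ‖g‖ ^ 2 + δ * ‖g‖) γ := hi2.add (hi1.const_mul _)
    rw [integral_add hi21 (hi4.div_const _),
      integral_add hi2 (hi1.const_mul _), integral_const_mul, integral_div, hI2]
    have := mul_le_mul_of_nonneg_left hI1 hδ0
    linarith
  have hdir := q.integral_directionError_le (chordalDistortion_hinge_le q hM) hd hd0
  have hdirm : AEStronglyMeasurable q.directionError γ := by
    have hh := q.Qh_nearest.1.comp (measurable_hinge (M := M) (L := L))
    have hs := fun i : Fin M => q.Qs_nearest.1.comp (measurable_normBlock (L := L) i)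
    simp only [Function.comp_def] at hh hs
    unfold HierarchicalQuantizer.directionError
    fun_prop
  have hmse : q.mse = ∫ g, (‖g‖ - q.Qρ ‖g‖) ^ 2 ∂γ +
      2 * ((∫ g, ‖g‖ * q.Qρ ‖g‖ ∂γ) * ∫ g, q.directionError g ∂γ) := by
    rw [← q.indepFun_directionError.integral_fun_mul_eq_mul_integral (by fun_prop) hdirm,
      ← integral_const_mul, ← integral_add hρi]
    · simp only [HierarchicalQuantizer.mse, q.sq_norm_sub_quantize]
      rfl
    · have := (integrable_sq_norm_sub_of_finite_range q.measurable_quantize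
        q.quantize_mem_codewords).sub hρi
      refine this.congr (Eventually.of_forall fun g => ?_)
      simp only [q.sq_norm_sub_quantize, Pi.sub_apply]
      ring
  have hlast : (∫ g, ‖g‖ * q.Qρ ‖g‖ ∂γ) * ∫ g, q.directionError g ∂γ ≤
      (N + δ * Real.sqrt N + (sqVariance + 1)) * (d + sqVariance / L) := by
    have h1 : 0 ≤ ∫ g, ‖g‖ * q.Qρ ‖g‖ ∂γ := integral_nonneg hU0
    refine (mul_le_mul_of_nonneg_left hdir h1).trans ?_
    rw [add_comm (sqVariance / (L : ℝ))]
    exact mul_le_mul_of_nonneg_right hUI (by positivity)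
  rw [hmse]
  linarith

end UpperBound

/-! ### Consequences of the bit allocation -/

section Allocation

variable {M L B : ℕ}

/-- The deviation of `log₂ λ*` from its limit `1 + log₂ (ln 2) - 2 B / (M L)`. -/
noncomputable def excessRate (M L : ℕ) : ℝ :=
  2 / (M * L) * Real.logb 2 (rhoMax M L / 2)
    + ((L - 1) / L * Real.logb 2 (2 * L / (L - 1)) - 1)
    + (2 / L + 1 / (M * L))
    + (M - 1) / (M * L) * Real.logb 2 (2 / (M - 1))
    + (M - 1) / (M * L) * Real.logb 2 (beta L * M * Real.sqrt L)

lemma logLambda_eq (M L B : ℕ) : logLambda M L B =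
    excessRate M L + 1 + Real.logb 2 (Real.log 2) - 2 * (B / (M * L)) := by
  unfold logLambda excessRate; ring

lemma bits_add_le (hM : M ≠ 0) (hL : L ≠ 0) (h : Realizable M L B) :
    (bitsNorm M L B).toNat + M * (bitsBlock M L B).toNat + (bitsHinge M L B).toNat ≤ B := by
  obtain ⟨h1, h2, h3⟩ := h
  have key : bitsNorm M L B + M * bitsBlock M L B + bitsHinge M L B ≤ B := by
    have e1 := Int.floor_le (realBitsNorm M L B)
    have e2 := mul_le_mul_of_nonneg_left (Int.floor_le (realBitsBlock M L B))
      (Nat.cast_nonneg (α := ℝ) M)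
    have e3 := Int.floor_le (realBitsHinge M L B)
    have := bit_constraint M L B hM hL
    have h4 : ((bitsNorm M L B + M * bitsBlock M L B + bitsHinge M L B : ℤ) : ℝ) ≤ B := by
      push_cast
      unfold bitsNorm bitsBlock bitsHinge
      linarith
    exact_mod_cast h4
  zify
  rw [Int.toNat_of_nonneg h1, Int.toNat_of_nonneg (by omega), Int.toNat_of_nonneg h3]
  exact key

lemma rhoMax_pos (hM : M ≠ 0) (hL : L ≠ 0) : 0 < rhoMax M L := by
  have : (0 : ℝ) < M * L := by positivity
  exact add_pos_of_pos_of_nonneg this (Real.sqrt_nonneg _)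

/-- Before rounding, half a step is `2 ^ (excessRate / 2 - B/(ML))`; the floor costs at most a
factor 2, and the negative rate term is dropped. -/
lemma half_step_le (hM : M ≠ 0) (hL : L ≠ 0) (h : 0 ≤ bitsNorm M L B) :
    rhoMax M L / 2 ^ (bitsNorm M L B).toNat / 2 ≤ 2 * (2 : ℝ) ^ (excessRate M L / 2) := by
  have hr : 0 < rhoMax M L / 2 := by linarith [rhoMax_pos hM hL]
  have h1 : (((bitsNorm M L B).toNat : ℤ) : ℝ) = bitsNorm M L B := by rw [Int.toNat_of_nonneg h]
  have h2 := Int.sub_one_lt_floor (realBitsNorm M L B)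
  have h3 : realBitsNorm M L B =
      Real.logb 2 (rhoMax M L / 2) + B / (M * L) - excessRate M L / 2 := by
    rw [realBitsNorm, logLambda_eq]; ring
  have h4 : rhoMax M L / 2 = (2 : ℝ) ^ Real.logb 2 (rhoMax M L / 2) :=
    (Real.rpow_logb (by norm_num) (by norm_num) hr).symm
  have h5 : (0 : ℝ) ≤ B / (M * L) := by positivity
  rw [div_right_comm, ← Real.rpow_natCast, div_le_iff₀ (by positivity), mul_assoc,
    ← Real.rpow_add two_pos]
  nth_rewrite 2 [← Real.rpow_one 2]
  rw [← Real.rpow_add two_pos]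
  rw [h4]
  apply Real.rpow_le_rpow_of_exponent_le one_le_two
  rw [← Int.cast_natCast, h1, bitsNorm]
  linarith

/-- The summand 1 in `realBitsBlock` pays for the sign bit and the floor costs the final `-1`. The
remaining term is nonnegative because `2L/(L - 1) ≥ 2`. -/
lemma block_bits_ge (hL : 2 ≤ L) {k : ℕ} (h : (bitsBlock M L B).toNat = k + 1) :
    ((L : ℝ) - 1) * (B / (M * L) - excessRate M L / 2) - 1 ≤ k := by
  have h0 : 0 ≤ bitsBlock M L B := by omega
  have hL' : (2 : ℝ) ≤ L := by exact_mod_cast hL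
  have h1 : (bitsBlock M L B : ℝ) = k + 1 := by
    have : bitsBlock M L B = k + 1 := by omega
    rw [this]; simp
  have h2 := Int.sub_one_lt_floor (realBitsBlock M L B)
  rw [← bitsBlock, h1] at h2
  have h3 : realBitsBlock M L B = ((L : ℝ) - 1) / 2 * (Real.logb 2 (2 * L / (L - 1)) - 1) +
      ((L : ℝ) - 1) * (B / (M * L) - excessRate M L / 2) + 1 := by
    rw [realBitsBlock, logLambda_eq]; ring
  have h4 : 1 ≤ Real.logb 2 (2 * L / (L - 1)) := by
    rw [Real.le_logb_iff_rpow_le (by norm_num) (by apply div_pos <;> linarith), Real.rpow_one,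
      le_div_iff₀ (by linarith)]
    linarith
  have h5 : 0 ≤ ((L : ℝ) - 1) / 2 * (Real.logb 2 (2 * L / (L - 1)) - 1) :=
    mul_nonneg (by linarith) (by linarith)
  linarith

/-- The relative excess of the random coding bound for a normalized block. -/
noncomputable def codingExcess (M L : ℕ) : ℝ :=
  (1 - 1 / (L : ℝ))⁻¹ * (2 * (L : ℝ) ^ 3) ^ (1 / ((L : ℝ) - 1)) * 2 ^ (excessRate M L / 2)

lemma coding_bound_le (hL : 2 ≤ L) {k : ℕ} (h : (bitsBlock M L B).toNat = k + 1) :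
    ((1 - 1 / (L : ℝ))⁻¹ * ((L : ℝ) ^ 3 / 2 ^ k) ^ (1 / ((L : ℝ) - 1))) ^ 2 ≤
      codingExcess M L ^ 2 * (2 : ℝ) ^ (-(2 * (B / (M * L)) : ℝ)) := by
  have hL' : (2 : ℝ) ≤ L := by exact_mod_cast hL
  have hL1 : (0 : ℝ) < L - 1 := by linarith
  have hm0 : 0 < 1 - 1 / (L : ℝ) := by
    have : 1 / (L : ℝ) ≤ 1 / 2 := one_div_le_one_div_of_le (by norm_num) hL'
    linarith
  have h1 := block_bits_ge hL h
  set κ := excessRate M L / 2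
  set R : ℝ := B / (M * L)
  have h2 : (L : ℝ) ^ 3 / 2 ^ k ≤ 2 * (L : ℝ) ^ 3 * (2 : ℝ) ^ ((L - 1) * (κ - R)) := by
    rw [div_le_iff₀ (by positivity), ← Real.rpow_natCast 2 k, mul_assoc, ← Real.rpow_add two_pos,
      mul_right_comm]
    have : 1 ≤ 2 * (2 : ℝ) ^ ((L - 1) * (κ - R) + k) := by
      nth_rewrite 1 [← Real.rpow_one 2]
      rw [← Real.rpow_add two_pos]
      apply Real.one_le_rpow one_le_two
      linarith
    nlinarith [pow_pos (by linarith : (0 : ℝ) < L) 3]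
  have h3 : ((L : ℝ) ^ 3 / 2 ^ k) ^ (1 / ((L : ℝ) - 1)) ≤
      (2 * (L : ℝ) ^ 3) ^ (1 / ((L : ℝ) - 1)) * 2 ^ (κ - R) := by
    refine (Real.rpow_le_rpow (by positivity) h2 (by positivity)).trans (le_of_eq ?_)
    rw [Real.mul_rpow (by positivity) (by positivity), ← Real.rpow_mul two_pos.le]
    congr 2
    field_simp
  have h4 : codingExcess M L ^ 2 * (2 : ℝ) ^ (-(2 * R)) =
      ((1 - 1 / (L : ℝ))⁻¹ * ((2 * (L : ℝ) ^ 3) ^ (1 / ((L : ℝ) - 1)) * 2 ^ (κ - R))) ^ 2 := by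
    have : (2 : ℝ) ^ (-(2 * R)) = ((2 : ℝ) ^ (-R)) ^ 2 := by
      rw [← Real.rpow_natCast, ← Real.rpow_mul two_pos.le]
      congr 1
      push_cast
      ring
    rw [this, ← mul_pow, codingExcess, sub_eq_add_neg κ, Real.rpow_add two_pos]
    congr 1
    ring
  rw [h4]
  gcongr

lemma chordalDistortion_block_le {bρ bs bh : ℕ} (q : HierarchicalQuantizer M L bρ bs bh)
    (hL : 2 ≤ L) {k : ℕ} (hk : bs = k + 1) (i : Fin M) :
    chordalDistortion (stdGaussian (Grad M L)) (fun g => normBlock g i) q.Cs ≤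
      ((1 - 1 / (L : ℝ))⁻¹ * ((L : ℝ) ^ 3 / 2 ^ k) ^ (1 / ((L : ℝ) - 1))) ^ 2 + 1 / L := by
  have : NeZero L := ⟨by omega⟩
  have h1 : ∀ᵐ g ∂(stdGaussian (Grad M L)), ‖normBlock g i‖ = 1 := by
    have h := ae_ne_zero_stdGaussian (E := EuclideanSpace ℝ (Fin L))
    rw [← map_block_stdGaussian (M := M) i] at h
    filter_upwards [ae_of_ae_map (measurable_block i).aemeasurable h] with g hg
    rw [normBlock_eq, normalized, norm_smul, norm_inv, norm_norm,
      inv_mul_cancel₀ (by simpa using hg)]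
  obtain ⟨C, hC1, hC2, hC3⟩ := exists_even_codebook_chordalDistortion_le hL
    (measurable_normBlock i) (fun g => norm_normalized_le_one _) h1 k
  subst hk
  exact (q.Cs_optimal C hC1 hC2 i).trans hC3

end Allocation

/-! ### Asymptotic estimates in the block length -/

section Asymptotics

lemma eventually_const_mul_rpow_le (C : ℝ) {ε : ℝ} (hε : 0 < ε) :
    ∀ᶠ L : ℕ in atTop, C * (L : ℝ) ^ (-(1 / 2) : ℝ) ≤ ε := by
  have h : Tendsto (fun L : ℕ => C * (L : ℝ) ^ (-(1 / 2) : ℝ)) atTop (nhds (C * 0)) :=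
    ((tendsto_rpow_neg_atTop (by norm_num : (0 : ℝ) < 1 / 2)).comp
      tendsto_natCast_atTop_atTop).const_mul C
  rw [mul_zero] at h
  exact h.eventually_le_const hε

lemma eventually_log_div_le (C : ℝ) {ε : ℝ} (hε : 0 < ε) :
    ∀ᶠ L : ℕ in atTop, C * (Real.log L / L) ≤ ε * (L : ℝ) ^ (-(1 / 2) : ℝ) := by
  have h := ((isLittleO_log_rpow_atTop (by norm_num : (0 : ℝ) < 1 / 2)).const_mul_left
    C).bound hε
  have h' := tendsto_natCast_atTop_atTop (R := ℝ) |>.eventually h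
  filter_upwards [h', eventually_ge_atTop 1] with L hL hL1
  have hL0 : (0 : ℝ) < L := by exact_mod_cast hL1
  have h1 := (le_abs_self _).trans hL
  rw [Real.norm_of_nonneg (by positivity)] at h1
  have h2 : (L : ℝ) ^ (-(1 / 2) : ℝ) = (L : ℝ) ^ (1 / 2 : ℝ) / L := by
    rw [eq_div_iff hL0.ne']
    nth_rewrite 2 [← Real.rpow_one (L : ℝ)]
    rw [← Real.rpow_add hL0]
    norm_num
  rw [h2, ← mul_div_assoc, ← mul_div_assoc]
  gcongr

lemma eventually_beta : ∀ᶠ L : ℕ in atTop, 1 ≤ beta L ∧ beta L ≤ 3 := by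
  have h : Tendsto (fun L : ℕ => (L : ℝ) ^ (-(1 / 16) : ℝ)) atTop (nhds 0) :=
    (tendsto_rpow_neg_atTop (by norm_num : (0 : ℝ) < 1 / 16)).comp tendsto_natCast_atTop_atTop
  filter_upwards [h.eventually_le_const (by norm_num : (0 : ℝ) < 1 / 2)] with L hL
  have h0 : 0 ≤ (L : ℝ) ^ (-(1 / 16) : ℝ) := by positivity
  rw [beta, one_le_div (by linarith), div_le_iff₀ (by linarith)]
  constructor <;> linarith

lemma sq_rpow_neg_half {L : ℕ} : ((L : ℝ) ^ (-(1 / 2) : ℝ)) ^ 2 = 1 / L := by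
  rw [← Real.rpow_natCast, ← Real.rpow_mul (by positivity)]
  norm_num
  rw [Real.rpow_neg_one]

lemma logb_two_mul_log_two (x : ℝ) : Real.logb 2 x * Real.log 2 = Real.log x :=
  div_mul_cancel₀ _ (Real.log_pos one_lt_two).ne'

lemma log_div_sub_one_le {L : ℕ} (hL : 2 ≤ L) : Real.log (L / (L - 1)) ≤ 2 / L := by
  have hL' : (2 : ℝ) ≤ L := by exact_mod_cast hL
  have hL1 : (0 : ℝ) < L - 1 := by linarith
  have h := Real.log_le_sub_one_of_pos (x := (L : ℝ) / (L - 1)) (by positivity)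
  have h1 : (L : ℝ) / (L - 1) - 1 = 1 / (L - 1) := by field_simp; ring
  have h2 : 1 / ((L : ℝ) - 1) ≤ 2 / L := by
    rw [div_le_div_iff₀ hL1 (by linarith)]; linarith
  linarith

/-- `log₂ λ*` approaches its limit at rate `(log L) / L`. -/
lemma excessRate_le {M : ℕ} (hM : 2 ≤ M) : ∃ C : ℝ, 0 ≤ C ∧ ∀ᶠ L : ℕ in atTop,
    excessRate M L * Real.log 2 ≤ (C + 2 * Real.log L) / L := by
  have hM' : (2 : ℝ) ≤ M := by exact_mod_cast hM
  have hlM : 0 ≤ Real.log M := Real.log_nonneg (by linarith)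
  have hl3 : 0 ≤ Real.log 3 := Real.log_nonneg (by norm_num)
  have hl2 : Real.log 2 ≤ 1 := by linarith [Real.log_two_lt_d9]
  -- The sum of the five bounds `a` to `e` below. The two `log L` come from the norm term `a` and
  -- the hinge term `e`; `log 3` comes from `beta L ≤ 3`.
  refine ⟨2 * Real.log M + Real.log 3 + 6, by positivity, ?_⟩
  filter_upwards [eventually_beta, eventually_ge_atTop 2] with L hβ hL
  have hL' : (2 : ℝ) ≤ L := by exact_mod_cast hL
  have hL0 : (0 : ℝ) < L := by linarith
  have hlL : 0 ≤ Real.log L := Real.log_nonneg (by linarith)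
  have hsL : Real.sqrt L ≤ L := by
    rw [Real.sqrt_le_left hL0.le]; nlinarith
  have hsL1 : 1 ≤ Real.sqrt L := Real.one_le_sqrt.2 (by linarith)
  have hfrac : ((M : ℝ) - 1) / (M * L) ≤ 1 / L := by
    rw [div_le_div_iff₀ (by positivity) hL0]; nlinarith
  have hfrac0 : 0 ≤ ((M : ℝ) - 1) / (M * L) := div_nonneg (by linarith) (by positivity)
  have hML : (4 : ℝ) ≤ M * L := by nlinarith
  have a : 2 / (M * L) * Real.log (rhoMax M L / 2) ≤ 1 / L * (Real.log M + Real.log L) := by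
    have h1 : rhoMax M L / 2 ≤ M * L := by
      have : Real.sqrt (2 * (M * L)) ≤ M * L := by
        rw [Real.sqrt_le_left (by positivity)]; nlinarith
      unfold rhoMax
      linarith
    have h2 : Real.log (rhoMax M L / 2) ≤ Real.log M + Real.log L := by
      rw [← Real.log_mul (by positivity) (by positivity)]
      exact Real.log_le_log (half_pos (rhoMax_pos (by omega) (by omega))) h1
    have h3 : 2 / ((M : ℝ) * L) ≤ 1 / L := by
      rw [div_le_div_iff₀ (by positivity) hL0]; nlinarith
    calc _ ≤ 2 / ((M : ℝ) * L) * (Real.log M + Real.log L) := by gcongr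
      _ ≤ _ := by gcongr
  have b : ((L : ℝ) - 1) / L * Real.log (2 * L / (L - 1)) - Real.log 2 ≤ 2 / L := by
    have h1 : Real.log (2 * L / (L - 1)) = Real.log 2 + Real.log (L / (L - 1)) := by
      rw [mul_div_assoc, Real.log_mul (by norm_num) (div_pos hL0 (by linarith)).ne']
    have h2 : 0 ≤ Real.log (2 * L / (L - 1)) := by
      apply Real.log_nonneg
      rw [one_le_div (by linarith)]
      linarith
    have h3 : ((L : ℝ) - 1) / L ≤ 1 := by rw [div_le_one hL0]; linarith
    have h4 := mul_le_mul_of_nonneg_right h3 h2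
    linarith [log_div_sub_one_le hL]
  have c : (2 / L + 1 / (M * L)) * Real.log 2 ≤ 3 / (L : ℝ) := by
    have h1 : 1 / ((M : ℝ) * L) ≤ 1 / L := by
      apply one_div_le_one_div_of_le hL0; nlinarith
    have h2 : (2 / L + 1 / (M * L)) * Real.log 2 ≤ (2 / L + 1 / (M * L) : ℝ) * 1 := by gcongr
    have h3 : 3 / (L : ℝ) = 2 / L + 1 / L := by ring
    linarith
  have d : ((M : ℝ) - 1) / (M * L) * Real.log (2 / (M - 1)) ≤ 1 / L := by
    have h1 : Real.log (2 / ((M : ℝ) - 1)) ≤ Real.log 2 := by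
      apply Real.log_le_log (div_pos two_pos (by linarith))
      rw [div_le_iff₀ (by linarith)]
      linarith
    have h2 := mul_le_mul_of_nonneg_left (h1.trans hl2) hfrac0
    linarith
  have e : ((M : ℝ) - 1) / (M * L) * Real.log (beta L * M * Real.sqrt L) ≤
      1 / L * (Real.log 3 + Real.log M + Real.log L) := by
    have h1 : Real.log (beta L * M * Real.sqrt L) ≤ Real.log 3 + Real.log M + Real.log L := by
      rw [← Real.log_mul (by norm_num) (by positivity), ← Real.log_mul (by positivity)
        (by positivity)]
      have := hβ.1
      apply Real.log_le_log (by positivity)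
      gcongr
      exact hβ.2
    calc _ ≤ ((M : ℝ) - 1) / (M * L) * (Real.log 3 + Real.log M + Real.log L) := by gcongr
      _ ≤ _ := by gcongr
  have key : excessRate M L * Real.log 2 = 2 / (M * L) * Real.log (rhoMax M L / 2) +
      (((L : ℝ) - 1) / L * Real.log (2 * L / (L - 1)) - Real.log 2) +
      (2 / L + 1 / (M * L)) * Real.log 2 +
      ((M : ℝ) - 1) / (M * L) * Real.log (2 / (M - 1)) +
      ((M : ℝ) - 1) / (M * L) * Real.log (beta L * M * Real.sqrt L) := by
    rw [← logb_two_mul_log_two (rhoMax M L / 2), ← logb_two_mul_log_two (2 * L / (L - 1)),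
      ← logb_two_mul_log_two (2 / (M - 1)), ← logb_two_mul_log_two (beta L * M * Real.sqrt L),
      excessRate]
    ring
  have hsum : (2 * Real.log M + Real.log 3 + 6 + 2 * Real.log L) / (L : ℝ) =
      1 / L * (Real.log M + Real.log L) + 2 / L + 3 / L + 1 / L +
        1 / L * (Real.log 3 + Real.log M + Real.log L) := by ring
  rw [key, hsum]
  linarith

lemma exp_le_one_add_two_mul {x : ℝ} (h0 : 0 ≤ x) (h1 : x ≤ 1 / 2) : Real.exp x ≤ 1 + 2 * x := by
  have h := Real.one_sub_le_exp_neg x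
  have h2 : Real.exp x * (1 - x) ≤ 1 := by
    calc Real.exp x * (1 - x) ≤ Real.exp x * Real.exp (-x) := by gcongr
      _ = 1 := by rw [← Real.exp_add]; simp
  have h3 : 1 ≤ (1 + 2 * x) * (1 - x) := by nlinarith
  exact le_of_mul_le_mul_right (h2.trans h3) (by linarith)

lemma codingExcess_eq_exp {M L : ℕ} (hL : 2 ≤ L) : codingExcess M L =
    Real.exp (Real.log (L / (L - 1)) + (Real.log 2 + 3 * Real.log L) / (L - 1) +
      excessRate M L * Real.log 2 / 2) := by
  have hL' : (2 : ℝ) ≤ L := by exact_mod_cast hL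
  have hL0 : (0 : ℝ) < L := by linarith
  have hL1 : (0 : ℝ) < L - 1 := by linarith
  have h1 : (1 - 1 / (L : ℝ))⁻¹ = L / (L - 1) := by field_simp
  rw [codingExcess, h1, Real.exp_add, Real.exp_add, Real.exp_log (by positivity),
    Real.rpow_def_of_pos (by positivity), Real.rpow_def_of_pos two_pos,
    Real.log_mul two_ne_zero (by positivity), Real.log_pow]
  have e1 : (Real.log 2 + ((3 : ℕ) : ℝ) * Real.log L) * (1 / (L - 1)) =
      (Real.log 2 + 3 * Real.log L) / (L - 1) := by push_cast; ring
  have e2 : Real.log 2 * (excessRate M L / 2) = excessRate M L * Real.log 2 / 2 := by ring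
  rw [e1, e2]

lemma codingExcess_le {M : ℕ} (hM : 2 ≤ M) : ∀ᶠ L : ℕ in atTop,
    codingExcess M L ^ 2 ≤ 1 + 1 / 5 * (L : ℝ) ^ (-(1 / 2) : ℝ) ∧
      2 * (2 : ℝ) ^ (excessRate M L / 2) ≤ 5 / 2 := by
  obtain ⟨C, hC, hex⟩ := excessRate_le hM
  -- Twice the logarithm of `codingExcess` is at most `(C + 8)/L + 14 log L / L`. Each part is made
  -- at most `u/20`, with `u = L^(-1/2)`, and `exp (u/10) ≤ 1 + u/5`.
  filter_upwards [hex, eventually_const_mul_rpow_le (C + 8) (by norm_num : (0 : ℝ) < 1 / 20),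
    eventually_log_div_le 14 (by norm_num : (0 : ℝ) < 1 / 20),
    eventually_const_mul_rpow_le 1 (by norm_num : (0 : ℝ) < 1),
    eventually_ge_atTop 2] with L hκ h8 hlog hu1 hL
  have hL' : (2 : ℝ) ≤ L := by exact_mod_cast hL
  have hL0 : (0 : ℝ) < L := by linarith
  have hlL : 0 ≤ Real.log L := Real.log_nonneg (by linarith)
  have hl2 : Real.log 2 ≤ 1 := by linarith [Real.log_two_lt_d9]
  have hu0 : 0 ≤ (L : ℝ) ^ (-(1 / 2) : ℝ) := by positivity
  have hsq := sq_rpow_neg_half (L := L)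
  set u := (L : ℝ) ^ (-(1 / 2) : ℝ)
  have hC8 : (C + 8) / L ≤ 1 / 20 * u := by
    have h := mul_le_mul_of_nonneg_right h8 hu0
    have : (C + 8) * u * u = (C + 8) / L := by rw [div_eq_mul_one_div, ← hsq]; ring
    linarith
  have hsplit : (C + 2 * Real.log L) / L = C / L + 2 * (Real.log L / L) := by ring
  have hsplit8 : (C + 8) / (L : ℝ) = C / L + 8 / L := by ring
  have hlogL : 0 ≤ Real.log L / L := by positivity
  have hCL : 0 ≤ C / (L : ℝ) := by positivity
  have h8L : 0 ≤ 8 / (L : ℝ) := by positivity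
  have hcod : 2 * (Real.log (L / (L - 1)) + (Real.log 2 + 3 * Real.log L) / (L - 1) +
      excessRate M L * Real.log 2 / 2) ≤ u / 10 := by
    have h1 := log_div_sub_one_le hL
    have h2 : (Real.log 2 + 3 * Real.log L) / ((L : ℝ) - 1) ≤ 2 / L + 6 * (Real.log L / L) := by
      have h3 : (Real.log 2 + 3 * Real.log L) / ((L : ℝ) - 1) ≤ (1 + 3 * Real.log L) / (L / 2) := by
        gcongr
        linarith
      refine h3.trans (le_of_eq ?_)
      field_simp
      ring
    have h4 : 8 / (L : ℝ) = 2 * (2 / L) + 2 * (2 / L) := by ring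
    linarith
  constructor
  · rw [codingExcess_eq_exp hL, ← Real.exp_nat_mul]
    push_cast
    refine (Real.exp_le_exp.2 hcod).trans ((exp_le_one_add_two_mul (by positivity)
      (by linarith)).trans (le_of_eq (by ring)))
  · rw [Real.rpow_def_of_pos two_pos]
    have h1 : Real.log 2 * (excessRate M L / 2) ≤ 1 / 20 := by linarith
    have h2 := (Real.exp_le_exp.2 h1).trans
      (exp_le_one_add_two_mul (by norm_num) (by norm_num))
    linarith

/-- Since `beta L ≥ 1`, the term `2(β + 1)L^(-1/2)` is at least `4 L^(-1/2)`. The negative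
contributions total at most `(35 + 2 log M)/L`, which is eventually below `L^(-1/2)`. -/
lemma log_two_add_le_cGap {M : ℕ} (hM : 2 ≤ M) : ∀ᶠ L : ℕ in atTop,
    Real.log 2 + 3 * (L : ℝ) ^ (-(1 / 2) : ℝ) ≤ cGap M L := by
  have hM' : (2 : ℝ) ≤ M := by exact_mod_cast hM
  have hlM : 0 ≤ Real.log M := Real.log_nonneg (by linarith)
  filter_upwards [eventually_beta, eventually_ge_atTop 2,
    eventually_const_mul_rpow_le (35 + 2 * Real.log M) one_pos] with L hβ hL hu
  have hL' : (2 : ℝ) ≤ L := by exact_mod_cast hL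
  have hL0 : (0 : ℝ) < L := by linarith
  have hu0 : 0 ≤ (L : ℝ) ^ (-(1 / 2) : ℝ) := by positivity
  have hsq := sq_rpow_neg_half (L := L)
  have hl2 : 0 ≤ Real.log 2 := Real.log_nonneg (by norm_num)
  have hML : (4 : ℝ) ≤ M * L := by nlinarith
  unfold cGap
  set u := (L : ℝ) ^ (-(1 / 2) : ℝ)
  have h1 : -(3 / (L : ℝ)) ≤
      -Real.log (2 * L / (L - 1)) + (L - 1) / L * Real.log (2 * L / (L - 1)) := by
    have e : -Real.log (2 * L / (L - 1)) + (L - 1) / L * Real.log (2 * L / (L - 1)) =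
        -(Real.log (2 * L / (L - 1)) / L) := by field_simp; ring
    rw [e]
    have hpos : (0 : ℝ) < L - 1 := by linarith
    have h := Real.log_le_sub_one_of_pos (x := 2 * (L : ℝ) / (L - 1)) (by positivity)
    have : 2 * (L : ℝ) / (L - 1) ≤ 4 := by rw [div_le_iff₀ hpos]; linarith
    gcongr
    linarith
  have h2 : 0 ≤ 2 / (M * L) * Real.log ((M * L + Real.sqrt (M * L)) / 2) := by
    refine mul_nonneg (by positivity) (Real.log_nonneg ?_)
    linarith [Real.sqrt_nonneg ((M : ℝ) * L)]
  have h3 : 0 ≤ 2 / (L : ℝ) * Real.log 2 := by positivity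
  have h4 : -(2 * Real.log M / L) ≤ 2 * (M - 1) / (M * L) * Real.log (2 / (M - 1)) := by
    have e1 : -Real.log M ≤ Real.log (2 / (M - 1)) := by
      rw [← Real.log_inv]
      apply Real.log_le_log (by positivity)
      rw [inv_eq_one_div, div_le_div_iff₀ (by positivity) (by linarith)]
      linarith
    have e2 : (2 * ((M : ℝ) - 1)) / (M * L) ≤ 2 / L := by
      rw [div_le_div_iff₀ (by positivity) hL0]; nlinarith
    have e3 : 0 ≤ (2 * ((M : ℝ) - 1)) / (M * L) :=
      div_nonneg (by linarith) (by positivity)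
    have e4 := mul_le_mul_of_nonneg_left e1 e3
    have e5 := mul_le_mul_of_nonneg_right e2 hlM
    have e6 : 2 * Real.log M / (L : ℝ) = 2 / L * Real.log M := by ring
    linarith
  have h5 : 0 ≤ Real.log 2 / (M * L) := by positivity
  have h6 : 0 ≤ ((M : ℝ) - 1) / (M * L) * Real.log (beta L * M * Real.sqrt L) := by
    refine mul_nonneg (div_nonneg (by linarith) (by positivity)) (Real.log_nonneg ?_)
    have hs : 1 ≤ Real.sqrt L := Real.one_le_sqrt.2 (by linarith)
    exact one_le_mul_of_one_le_of_one_le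
      (one_le_mul_of_one_le_of_one_le hβ.1 (by linarith)) hs
  have h7 : 4 * u ≤ 2 * (beta L + 1) * u := by
    apply mul_le_mul_of_nonneg_right _ hu0
    linarith [hβ.1]
  have h8 : 2 * (beta L + 1) ^ 2 * (L : ℝ)⁻¹ ≤ 32 / L := by
    rw [← div_eq_mul_inv]
    gcongr
    nlinarith [hβ.1, hβ.2]
  have h9 : 3 / (L : ℝ) + 2 * Real.log M / L + 32 / L ≤ u := by
    have e1 : 3 / (L : ℝ) + 2 * Real.log M / L + 32 / L = (35 + 2 * Real.log M) * u * u := by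
      rw [mul_assoc, ← sq, hsq]; ring
    rw [e1]
    linarith [mul_le_mul_of_nonneg_right hu hu0]
  linarith

/-- With `N = ML` and `u = L^(-1/2)`, `N * u² = M ≥ 2`, so constants are eventually at most `u/40 *
N` and `√N ≤ 0.71 * u * N`. The bound `p ≥ 1/4` makes additive errors relative to `p`. -/
lemma total_error_le {M : ℕ} (hM : 2 ≤ M) (C : ℝ) (hC : 0 ≤ C) : ∀ᶠ L : ℕ in atTop,
    ∀ p : ℝ, 1 / 4 ≤ p → p ≤ 1 → 2 * (5 / 2) ^ 2 + 2 * (C + 1) +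
      2 * (M * L + 5 / 2 * Real.sqrt (M * L) + (C + 1)) *
        (codingExcess M L ^ 2 * p + 1 / L + C / L) ≤
      M * L * (2 * p * (1 + 3 * (L : ℝ) ^ (-(1 / 2) : ℝ))) := by
  have hM' : (2 : ℝ) ≤ M := by exact_mod_cast hM
  filter_upwards [codingExcess_le hM, eventually_ge_atTop 2,
    eventually_const_mul_rpow_le (25 / 2 + 2 * (C + 1)) (by norm_num : (0 : ℝ) < 1 / 40),
    eventually_const_mul_rpow_le 1 (by norm_num : (0 : ℝ) < 1)]
    with L hcod hL hu hu1 p hp4 hp1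
  have hX := hcod.1
  have hL' : (2 : ℝ) ≤ L := by exact_mod_cast hL
  have hL0 : (0 : ℝ) < L := by linarith
  have hu0 : 0 ≤ (L : ℝ) ^ (-(1 / 2) : ℝ) := by positivity
  have hsq := sq_rpow_neg_half (L := L)
  set u := (L : ℝ) ^ (-(1 / 2) : ℝ)
  set X := codingExcess M L ^ 2
  set N : ℝ := M * L with hN
  have hN0 : 0 < N := by positivity
  have hN2 : 2 ≤ N * u ^ 2 := by
    rw [hsq, hN]
    field_simp
    exact hM'
  have hsqrt : Real.sqrt N ≤ 71 / 100 * u * N := by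
    rw [Real.sqrt_le_left (by positivity)]
    nlinarith
  have hconst : ∀ c : ℝ, 0 ≤ c → c * u ≤ 1 / 40 → c ≤ u / 40 * N := by
    intro c hc hcu
    have h1 : c * 1 ≤ c * (N * u ^ 2) := by gcongr; linarith
    have h2 : c * u * (N * u) ≤ 1 / 40 * (N * u) := by gcongr
    linarith
  have hC1 : (C + 1) * u ≤ 1 / 40 := by
    have : (C + 1) * u ≤ (25 / 2 + 2 * (C + 1)) * u :=
      mul_le_mul_of_nonneg_right (by linarith) hu0
    linarith
  have e1 := hconst _ (by positivity) hu
  have e2 := hconst _ (by positivity) hC1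
  have e3 : 1 / (L : ℝ) + C / L ≤ u / 10 * p := by
    have : 1 / (L : ℝ) + C / L = (C + 1) * u * u := by rw [mul_assoc, ← sq, hsq]; ring
    rw [this]
    have h1 := mul_le_mul_of_nonneg_right hC1 hu0
    have h2 := mul_le_mul_of_nonneg_left hp4 hu0
    linarith
  have e4 : X * p ≤ (1 + 1 / 5 * u) * p := by gcongr
  have e5 : 0 ≤ X * p + 1 / L + C / L := by positivity
  -- Here `5/2 * 0.71 + 1/40 ≤ 15/8` and `1/5 + 1/10 = 3/10`. With `u ≤ 1` and the separate
  -- constants, the total coefficient of `u` remains below 3.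
  have e6 : 2 * (N + 5 / 2 * Real.sqrt N + (C + 1)) * (X * p + 1 / L + C / L) ≤
      2 * (N * (1 + 15 / 8 * u)) * ((1 + 3 / 10 * u) * p) := by
    apply mul_le_mul _ _ e5 (by positivity)
    · linarith [mul_nonneg hu0 hN0.le]
    · linarith
  have e7 : u / 40 * N ≤ u / 10 * N * p := by
    linarith [mul_le_mul_of_nonneg_left hp4 (mul_nonneg hu0 hN0.le)]
  have e8 : N * p * u ^ 2 ≤ N * p * u := by
    rw [sq, ← mul_assoc]
    exact mul_le_of_le_one_right (by positivity) (by linarith)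
  have e9 : 0 ≤ N * p * u := by positivity
  linarith

end Asymptotics

end HierQuant

/-! ### Main theorem -/

open HierQuant
theorem theorem1 (M : ℕ) (hM : 2 ≤ M) :
    ∃ err : ℕ → ℝ, err =O[atTop] (fun L : ℕ => (L : ℝ) ^ (-(3 / 2) : ℝ)) ∧
      ∀ᶠ L : ℕ in atTop, ∀ B : ℕ, B ≤ M * L → Realizable M L B →
        ∀ q : HierarchicalQuantizer M L (bitsNorm M L B).toNat (bitsBlock M L B).toNat
            (bitsHinge M L B).toNat,
          Integrable (fun g => ‖g - q.quantize g‖ ^ 2) (stdGaussian (Grad M L)) ∧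
          0 < q.mse ∧
          -(2 * Real.log 2 / (M * L)) * B ≤ Real.log (q.mse / (M * L)) ∧
          Real.log (q.mse / (M * L)) ≤ cGap M L - 2 * Real.log 2 / (M * L) * B + err L := by
  -- The slack in the `L^(-1/2)` term of `cGap` absorbs every lower-order error.
  refine ⟨0, isBigO_zero _ _, ?_⟩
  filter_upwards [codingExcess_le hM, log_two_add_le_cGap hM,
    total_error_le hM sqVariance sqVariance_nonneg, eventually_ge_atTop 2] with
    L hcode hgap htotal hL B hB hreal q
  have hM0 : M ≠ 0 := by omega
  have hL0 : L ≠ 0 := by omega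
  have : NeZero L := ⟨hL0⟩
  have : NeZero M := ⟨hM0⟩
  have hN : (0 : ℝ) < M * L := by positivity
  have hcard : (Fintype.card (Fin M × Fin L) : ℝ) = M * L := by simp
  obtain ⟨hpos, hlow⟩ := rate_distortion_lower_bound q.measurable_quantize
    q.quantize_mem_codewords
  rw [hcard] at hlow
  change 0 < q.mse at hpos
  change _ ≤ Real.log (q.mse / _) at hlow
  refine ⟨integrable_sq_norm_sub_of_finite_range q.measurable_quantize q.quantize_mem_codewords,
    hpos, ?_, ?_⟩
  · refine le_trans ?_ hlow
    have h1 : Real.log q.codewords.card ≤ B * Real.log 2 := by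
      rw [← Real.log_pow]
      refine Real.log_le_log ?_ ?_
      · exact_mod_cast Finset.card_pos.2 ⟨_, q.quantize_mem_codewords 0⟩
      · exact_mod_cast q.card_codewords_le.trans
          (Nat.pow_le_pow_right two_pos (bits_add_le hM0 hL0 hreal))
    have h2 : 2 / ((M : ℝ) * L) * Real.log q.codewords.card ≤
        2 / (M * L) * (B * Real.log 2) := by gcongr
    have h3 : 2 / ((M : ℝ) * L) * (B * Real.log 2) = 2 * Real.log 2 / (M * L) * B := by ring
    linarith
  · obtain ⟨k, hk⟩ : ∃ k, (bitsBlock M L B).toNat = k + 1 :=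
      ⟨(bitsBlock M L B).toNat - 1, by have := hreal.2.1; omega⟩
    set R : ℝ := B / (M * L) with hR
    have hR0 : 0 ≤ R := by positivity
    have hR1 : R ≤ 1 := by
      rw [hR, div_le_one hN]
      exact_mod_cast hB
    set p : ℝ := (2 : ℝ) ^ (-(2 * R))
    have hp1 : p ≤ 1 := Real.rpow_le_one_of_one_le_of_nonpos one_le_two (by linarith)
    -- Here `B ≤ ML` enters: the rate `R` is at most one bit per coordinate.
    have hp4 : 1 / 4 ≤ p := by
      calc (1 / 4 : ℝ) = (2 : ℝ) ^ (-2 : ℝ) := by norm_num [Real.rpow_neg]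
        _ ≤ p := Real.rpow_le_rpow_of_exponent_le one_le_two (by linarith)
    have hp0 : 0 < p := by linarith
    have hd : ∀ i, chordalDistortion (stdGaussian (Grad M L)) (fun g => normBlock g i) q.Cs ≤
        codingExcess M L ^ 2 * p + 1 / L := fun i =>
      (chordalDistortion_block_le q hL hk i).trans
        (add_le_add_left (coding_bound_le hL hk) _)
    have hmse := q.mse_le hM (by positivity) hd
      ((half_step_le hM0 hL0 hreal.1).trans hcode.2)
    have hfin := hmse.trans (htotal p hp4 hp1)
    have hu : 0 ≤ (L : ℝ) ^ (-(1 / 2) : ℝ) := by positivity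
    have h1 : Real.log (q.mse / (M * L)) ≤ Real.log 2 + Real.log p +
        3 * (L : ℝ) ^ (-(1 / 2) : ℝ) := by
      have h2 : q.mse / (M * L) ≤ 2 * p * (1 + 3 * (L : ℝ) ^ (-(1 / 2) : ℝ)) := by
        rw [div_le_iff₀ hN]; linarith
      refine (Real.log_le_log (by positivity) h2).trans ?_
      rw [Real.log_mul (by positivity) (by positivity), Real.log_mul (by norm_num) hp0.ne']
      have := Real.log_le_sub_one_of_pos (by positivity : 0 < 1 + 3 * (L : ℝ) ^ (-(1 / 2) : ℝ))
      linarith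
    have h2 : Real.log p = -(2 * Real.log 2 / (M * L) * B) := by
      rw [Real.log_rpow two_pos, hR]; ring
    simp only [Pi.zero_apply, add_zero]
    linarith
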